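/- Consider a set $U$ of $m$ items and $n$ bidders. Bidder $i$ has a type $(v_i,B_i)$: a normalized ($v_i(\emptyset)=0$), non-decreasing valuation $v_i:2^U\to\mathbb R_{\ge 0}$ and a budget $B_i\ge 0$. Her liquid valuation is $\bar v_i(S)=\min\{v_i(S),B_i\}$. For a profile $\bar{\mathbf v}=(\bar v_1,\dots,\bar v_n)$ and an allocation $\mathcal S=(S_1,\dots,S_n)$ (pairwise disjoint bundles) the liquid welfare is $\bar{\mathbf v}(\mathcal S)=\sum_i\bar v_i(S_i)$. A set function $v$ is XOS if it is the pointwise maximum of a family of additive functions with non-negative values. Given item prices $p_j\ge 0$, write $p(S)=\sum_{j\in S}p_j$. In the posted-price mechanism the bidders arrive one by one in an order $\pi$; when bidder $i$ arrives and $U_i$ is the set of unsold items, she takes the answer of a budget-constrained demand query (BCDQ), i.e. a set $S\subseteq U_i$ maximizing $v_i(S)-p(S)$ subject to $p(S)\le B_i$ (ties are broken by an arbitrary fixed rule depending on the bidder, her type and $U_i$). The types of the bidders are drawn independently from distributions such that, almost surely, every $\bar v_i$ is XOS and $\bar v_i(U)\le H$, for a known bound $H>0$ (for instance $H=1$, for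 normalized liquid valuations). Let $\mathcal D$ be the resulting product distribution of $\bar{\mathbf v}$. A program can draw independent samples from $\mathcal D$, and for each sampled profile $\bar{\mathbf v}$ it has black-box access to (i) $\mathrm{ALG}(\bar{\mathbf v})$, where $\mathrm{ALG}$ is any deterministic algorithm that maps profiles of XOS functions to allocations (for instance an $O(1)$-approximation algorithm for the liquid welfare), and (ii) an XOS value oracle, which on a bidder $i$ and a set $T\subseteq U$ returns an additive function $A\ge 0$ with $A(S)\le\bar v_i(S)$ for all $S\subseteq U$ and $A(T)=\bar v_i(T)$. Then there is one program on a real-number random access machine (unit-cost arithmetic, comparisons and oracle calls) which, for all $m,n$, all $\varepsilon>0$, $\delta\in(0,1)$, $H>0$, and all such distributions, algorithms $\mathrm{ALG}$ and oracles, given the input $(m,n,\varepsilon,\delta,H)$ halts within $\mathrm{poly}(m,n,H/\varepsilon,\log(1/\delta))$ steps and outputs item prices which, with probability at least $1-\delta$ over the samples, are non-negative and have the following property: for every arrival order $\pi$ (and every tie-breaking rule) the expected liquid welfare of the posted-price mechanism with BCDQs under these prices is at least $$\tfrac14\,\mathbb E_{\bar{\mathbf v}\sim\mathcal D}\bigl[\bar{\mathbf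 v}(\mathrm{ALG}(\bar{\mathbf v}))\bigr]-\varepsilon .$$ -/

import Mathlib

open MeasureTheory

namespace LiquidAuction

/-! ### Combinatorial auctions with budgets

Items are `Fin m`, bidders are `Fin n`. -/

/-- Set functions on the items. -/
abbrev SetValuation (m : ℕ) : Type := Finset (Fin m) → ℝ

/-- The private type of a bidder: a valuation function and a budget. -/
abbrev BidderType (m : ℕ) : Type := SetValuation m × ℝ

/-- Valuations are normalized and non-decreasing (hence non-negative), budgets are
non-negative. -/
def IsBidderType {m : ℕ} (θ : BidderType m) : Prop :=
  θ.1 ∅ = 0 ∧ Monotone θ.1 ∧ 0 ≤ θ.2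

/-- The liquid valuation `S ↦ min {v(S), B}`. -/
noncomputable def liquid {m : ℕ} (θ : BidderType m) : SetValuation m :=
  fun S => min (θ.1 S) θ.2

/-- The profile of liquid valuations. -/
noncomputable def liquidProfile {m n : ℕ} (θ : Fin n → BidderType m) : Fin n → SetValuation m :=
  fun i => liquid (θ i)

/-- XOS (fractionally subadditive): a pointwise maximum of a family of non-negative additive
functions. An additive function is given by its values on the single items. -/
def IsXOS {m : ℕ} (v : SetValuation m) : Prop :=
  ∃ W : Set (Fin m → ℝ), (∀ w ∈ W, ∀ j, 0 ≤ w j) ∧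
    ∀ S, IsGreatest ((fun w : Fin m → ℝ => ∑ j ∈ S, w j) '' W) (v S)

/-- The welfare of an allocation `S` under a profile `v` (it is the liquid welfare when `v` is a
profile of liquid valuations). -/
def welfare {m n : ℕ} (v : Fin n → SetValuation m) (S : Fin n → Finset (Fin m)) : ℝ :=
  ∑ i, v i (S i)

/-- `ALG` turns each profile of XOS valuations into an allocation: no item is given to two
bidders. It is a measurable map into a finite set. -/
def IsAllocationAlgorithm {m n : ℕ} (ALG : (Fin n → SetValuation m) → Fin n → Finset (Fin m)) :
    Prop :=
  (∀ v, (∀ i, IsXOS (v i)) → ∀ i k, i ≠ k → Disjoint (ALG v i) (ALG v k)) ∧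
    ∀ i S, MeasurableSet {v | ALG v i = S}

/-- An XOS value oracle: for bidder `i` with XOS valuation `v`, the query `T` is answered by an
additive function `A` (given by its values on the single items) with `A(S) ≤ v(S)` for
all `S` and `A(T) = v(T)`. -/
def IsXOSOracle {m n : ℕ} (X : Fin n → SetValuation m → Finset (Fin m) → Fin m → ℝ) : Prop :=
  (∀ i v, IsXOS v → ∀ T, (∀ j, 0 ≤ X i v T j) ∧ (∀ S, ∑ j ∈ S, X i v T j ≤ v S) ∧
      ∑ j ∈ T, X i v T j = v T) ∧
    ∀ i T j, Measurable fun v => X i v T j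

/-- `S` is an answer to the budget-constrained demand query with valuation `θ.1`, available
items `U`, prices `p` and budget `θ.2`. -/
def IsBCDQ {m : ℕ} (θ : BidderType m) (U : Finset (Fin m)) (p : Fin m → ℝ)
    (S : Finset (Fin m)) : Prop :=
  S ⊆ U ∧ ∑ j ∈ S, p j ≤ θ.2 ∧
    ∀ T ⊆ U, ∑ j ∈ T, p j ≤ θ.2 → θ.1 T - ∑ j ∈ T, p j ≤ θ.1 S - ∑ j ∈ S, p j

/-- `br i θ U` is what bidder `i` of type `θ` buys at prices `p` if the items `U` are available: an
answer to her budget-constrained demand query, with ties broken by an arbitrary measurable rule. -/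
def IsBCDQRule {m n : ℕ} (p : Fin m → ℝ)
    (br : Fin n → BidderType m → Finset (Fin m) → Finset (Fin m)) : Prop :=
  (∀ i θ, IsBidderType θ → ∀ U, IsBCDQ θ U p (br i θ U)) ∧
    ∀ i U S, MeasurableSet {θ | br i θ U = S}

/-- The posted-price mechanism: the listed bidders arrive one by one, each takes her bundle from
the items `U` that are still available. -/
def postedPrice {m n : ℕ} (br : Fin n → BidderType m → Finset (Fin m) → Finset (Fin m))
    (θ : Fin n → BidderType m) : List (Fin n) → Finset (Fin m) → Fin n → Finset (Fin m)
  | [], _ => fun _ => ∅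
  | i :: l, U =>
      Function.update (postedPrice br θ l (U \ br i (θ i) U)) i (br i (θ i) U)

/-- The outcome of the posted-price mechanism when bidder `π k` arrives in position `k`. -/
def outcome {m n : ℕ} (br : Fin n → BidderType m → Finset (Fin m) → Finset (Fin m))
    (π : Equiv.Perm (Fin n)) (θ : Fin n → BidderType m) : Fin n → Finset (Fin m) :=
  postedPrice br θ (List.ofFn π) Finset.univ

/-- The prices `p` are non-negative and, for every arrival order and however the bidders break
ties, the expected liquid welfare of the posted-price mechanism is at least a quarter of
the expected liquid welfare of `ALG`, minus `ε`. Bidder `i` has a type of law `τ i`, and the types are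
independent. -/
def GoodPrices {m n : ℕ} (τ : Fin n → Measure (BidderType m))
    (ALG : (Fin n → SetValuation m) → Fin n → Finset (Fin m)) (ε : ℝ) (p : Fin m → ℝ) : Prop :=
  (∀ j, 0 ≤ p j) ∧
    ∀ (π : Equiv.Perm (Fin n)) (br : Fin n → BidderType m → Finset (Fin m) → Finset (Fin m)),
      IsBCDQRule p br →
        (1 / 4) * (∫ θ, welfare (liquidProfile θ) (ALG (liquidProfile θ)) ∂(Measure.pi τ)) - ε ≤
          ∫ θ, welfare (liquidProfile θ) (outcome br π θ) ∂(Measure.pi τ)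

/-! ### A real random access machine with sample access, `ALG` and an XOS value oracle

Programs are finite and do not depend on the instance. There are real registers, index
registers (natural numbers, used as addresses) and real arrays. Each elementary operation and each
oracle call is one step. -/

/-- Comparisons: of two real registers, or of two index registers. -/
inductive Test : Type
  | regLt (a b : ℕ)
  | idxLt (i j : ℕ)

/-- Programs. -/
inductive Prog : Type
  /-- `reg r := q` -/
  | const (r : ℕ) (q : ℚ)
  /-- `reg r := reg a + reg b` -/
  | add (r a b : ℕ)
  /-- `reg r := reg a - reg b` -/
  | sub (r a b : ℕ)
  /-- `reg r := reg a * reg b` -/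
  | mul (r a b : ℕ)
  /-- `reg r := reg a / reg b` -/
  | div (r a b : ℕ)
  /-- `reg r := arr a [idx i]` -/
  | load (r a i : ℕ)
  /-- `arr a [idx i] := reg r` -/
  | store (a i r : ℕ)
  /-- `idx i := 0` -/
  | zero (i : ℕ)
  /-- `idx i := idx i + 1` -/
  | succ (i : ℕ)
  /-- replace the profile at hand by a fresh sample -/
  | draw
  /-- `reg r := 1` if `ALG`, on the profile at hand, gives item `idx j` to bidder `idx i`,
  otherwise `reg r := 0` -/
  | alg (r i j : ℕ)
  /-- XOS value query for bidder `idx i` of the profile at hand and the set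
  `T = {l | arr a [l] ≠ 0}`; `reg r :=` the value at item `idx j` of the additive function
  returned -/
  | xos (r i a j : ℕ)
  /-- do nothing -/
  | skip
  /-- run the first program, then the second -/
  | seq (c d : Prog)
  /-- run the first program if the test succeeds, otherwise the second -/
  | ite (t : Test) (c d : Prog)
  /-- repeat the program as long as the test succeeds -/
  | loop (t : Test) (c : Prog)

/-- The contents of the memory, and the number of samples drawn so far. -/
structure Memory : Type where
  reg : ℕ → ℝ
  idx : ℕ → ℕ
  arr : ℕ → ℕ → ℝ
  drawn : ℕ

/-- What a program has access to: a stream of sampled profiles, `ALG` and the XOS value oracle. Only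
the profile at hand (number `drawn` of the stream) can be queried; the first one is at hand at the
start. -/
structure Access (m n : ℕ) : Type where
  samples : ℕ → Fin n → SetValuation m
  ALG : (Fin n → SetValuation m) → Fin n → Finset (Fin m)
  X : Fin n → SetValuation m → Finset (Fin m) → Fin m → ℝ

/-- The result of a test. -/
def Test.Holds (s : Memory) : Test → Prop
  | .regLt a b => s.reg a < s.reg b
  | .idxLt i j => s.idx i < s.idx j

/-- `reg r := x`. -/
def Memory.setReg (s : Memory) (r : ℕ) (x : ℝ) : Memory :=
  { s with reg := Function.update s.reg r x }

/-- `idx i := k`. -/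
def Memory.setIdx (s : Memory) (i k : ℕ) : Memory :=
  { s with idx := Function.update s.idx i k }

/-- `arr a [k] := x`. -/
def Memory.setArr (s : Memory) (a k : ℕ) (x : ℝ) : Memory :=
  { s with arr := Function.update s.arr a (Function.update (s.arr a) k x) }

open Classical in
/-- The answer to `alg` for bidder `i` and item `j` (`0` if there is no such bidder or item). -/
noncomputable def Access.algBit {m n : ℕ} (A : Access m n) (s : Memory) (i j : ℕ) : ℝ :=
  if h : i < n ∧ j < m then
    if (⟨j, h.2⟩ : Fin m) ∈ A.ALG (A.samples s.drawn) ⟨i, h.1⟩ then 1 else 0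
  else 0

open Classical in
/-- The answer to `xos` for bidder `i`, the set stored in array `a`, and item `j` (`0` if there is no
such bidder or item). -/
noncomputable def Access.xosValue {m n : ℕ} (A : Access m n) (s : Memory) (i a j : ℕ) : ℝ :=
  if h : i < n ∧ j < m then
    A.X ⟨i, h.1⟩ (A.samples s.drawn ⟨i, h.1⟩)
      (Finset.univ.filter fun l : Fin m => s.arr a l ≠ 0) ⟨j, h.2⟩
  else 0

open Classical in
/-- One step of the machine. A configuration is the list of the programs that are still to be run,
together with the memory; the machine has halted when the list is empty. -/
noncomputable def step {m n : ℕ} (A : Access m n) : List Prog × Memory → List Prog × Memory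
  | ([], s) => ([], s)
  | (.const r q :: K, s) => (K, s.setReg r (q : ℝ))
  | (.add r a b :: K, s) => (K, s.setReg r (s.reg a + s.reg b))
  | (.sub r a b :: K, s) => (K, s.setReg r (s.reg a - s.reg b))
  | (.mul r a b :: K, s) => (K, s.setReg r (s.reg a * s.reg b))
  | (.div r a b :: K, s) => (K, s.setReg r (s.reg a / s.reg b))
  | (.load r a i :: K, s) => (K, s.setReg r (s.arr a (s.idx i)))
  | (.store a i r :: K, s) => (K, s.setArr a (s.idx i) (s.reg r))
  | (.zero i :: K, s) => (K, s.setIdx i 0)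
  | (.succ i :: K, s) => (K, s.setIdx i (s.idx i + 1))
  | (.draw :: K, s) => (K, { s with drawn := s.drawn + 1 })
  | (.alg r i j :: K, s) => (K, s.setReg r (A.algBit s (s.idx i) (s.idx j)))
  | (.xos r i a j :: K, s) => (K, s.setReg r (A.xosValue s (s.idx i) a (s.idx j)))
  | (.skip :: K, s) => (K, s)
  | (.seq c d :: K, s) => (c :: d :: K, s)
  | (.ite t c d :: K, s) => if t.Holds s then (c :: K, s) else (d :: K, s)
  | (.loop t c :: K, s) => if t.Holds s then (c :: .loop t c :: K, s) else (K, s)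

/-- The memory at the start: `ε`, `δ`, `H` are in the real registers `0`, `1`, `2`, and `m`, `n` are in the
index registers `0`, `1`; everything else is `0`. -/
noncomputable def startMemory (m n : ℕ) (ε δ H : ℝ) : Memory where
  reg := fun r => if r = 0 then ε else if r = 1 then δ else if r = 2 then H else 0
  idx := fun i => if i = 0 then m else if i = 1 then n else 0
  arr := fun _ _ => 0
  drawn := 0

/-- Started on the input `(m, n, ε, δ, H)`, the program halts after at most `t` steps, and then array `0`
contains the price vector `p`. -/
def ComputesPrices {m n : ℕ} (prog : Prog) (A : Access m n) (ε δ H : ℝ) (t : ℕ)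
    (p : Fin m → ℝ) : Prop :=
  ((step A)^[t] ([prog], startMemory m n ε δ H)).1 = [] ∧
    ∀ j : Fin m, ((step A)^[t] ([prog], startMemory m n ε δ H)).2.arr 0 j = p j

end LiquidAuction

open LiquidAuction

/-!
Fix for each profile the additive functions supporting the bundles of `ALG`, and let `itemValue` of
an item be the value that its owner under `ALG` gets from it. These values add up to the welfare of
`ALG`. If the price of item `j` is (about) half of its expected value `Q j`, then an item that is sold
brings revenue `Q j / 2`, and an item that stays unsold was available to every bidder at a price
that leaves a gain of `Q j / 2`. To make the second half precise, a bidder imagines fresh samples of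
the types of the others and considers the still available items that `ALG` would give her and that
are worth their price. What is available to her depends only on the types of the others, so
exchanging her coordinate between the real and the imagined profile, which preserves their joint
law, shows that availability and gain are independent (`integral_mul_resample`). With
budgets, a bidder compares her bundle `S` with another bundle only if the latter is affordable, which
costs a factor `2`: revenue plus gain is at most `2` times the liquid welfare
(`IsBCDQ.liquid_sub_add_le`, `revenue_add_surplus_le`). Hence the factor `1 / 4`
(`goodPrices_of_abs_sub_le`).

The numbers `Q j` are estimated by empirical means. The item values lie in `[0, H]`, so by Hoeffding's
inequality and a union bound, about `(m H / ε) ^ 2 * (m + log (1 / δ))` samples give all of them up to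
`4 ε / (m + 1)` with probability `1 - δ` (`measure_exists_abs_sum_sub_ge_le`).

The program `priceProg` computes the means. The machine has no logarithm; instead of `log (1 / δ)` it
uses the number of doublings that raise `δ` to at least `1`. Its correctness and its running time
are proved together with the relation `Runs`, by one loop rule with counted rounds (`Runs.loop`).
-/

namespace LiquidAuction

/-! ### XOS valuations and the support of the algorithm's allocation -/

theorem IsXOS.monotone {m : ℕ} {v : SetValuation m} (hv : IsXOS v) : Monotone v := by
  obtain ⟨W, hW, hmax⟩ := hv
  intro S T hST
  obtain ⟨w, hw, hwS⟩ := (hmax S).1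
  have hT := (hmax T).2 ⟨w, hw, rfl⟩
  rw [← hwS]
  exact (Finset.sum_le_sum_of_subset_of_nonneg hST fun j _ _ => hW w hw j).trans hT

open Classical in
/-- The part of the welfare of `ALG` on the profile `v` that bidder `i` draws from item `j`: the
value at `j` of the additive function supporting her bundle, and `0` if she does not get `j`. -/
noncomputable def supportValue {m n : ℕ} (ALG : (Fin n → SetValuation m) → Fin n → Finset (Fin m))
    (X : Fin n → SetValuation m → Finset (Fin m) → Fin m → ℝ) (i : Fin n) (j : Fin m)
    (v : Fin n → SetValuation m) : ℝ :=
  if j ∈ ALG v i then X i (v i) (ALG v i) j else 0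

/-- The contribution of item `j` to the welfare of `ALG` on the profile `v`. -/
noncomputable def itemValue {m n : ℕ} (ALG : (Fin n → SetValuation m) → Fin n → Finset (Fin m))
    (X : Fin n → SetValuation m → Finset (Fin m) → Fin m → ℝ) (v : Fin n → SetValuation m)
    (j : Fin m) : ℝ :=
  ∑ i, supportValue ALG X i j v

open Classical in
/-- What bidder `i` would gain from item `j` of her bundle under `ALG` if she could buy it at price
`p j`; she declines an item that is too expensive. -/
noncomputable def surplus {m n : ℕ} (ALG : (Fin n → SetValuation m) → Fin n → Finset (Fin m))
    (X : Fin n → SetValuation m → Finset (Fin m) → Fin m → ℝ) (p : Fin m → ℝ) (i : Fin n)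
    (j : Fin m) (v : Fin n → SetValuation m) : ℝ :=
  if j ∈ ALG v i then max (X i (v i) (ALG v i) j - p j) 0 else 0

section Support

variable {m n : ℕ} {ALG : (Fin n → SetValuation m) → Fin n → Finset (Fin m)}
  {X : Fin n → SetValuation m → Finset (Fin m) → Fin m → ℝ} {v : Fin n → SetValuation m}

theorem supportValue_nonneg (hX : IsXOSOracle X) (hv : ∀ i, IsXOS (v i)) (i : Fin n)
    (j : Fin m) : 0 ≤ supportValue ALG X i j v := by
  unfold supportValue
  split_ifs
  · exact (hX.1 i _ (hv i) _).1 j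
  · exact le_rfl

theorem oracle_le (hX : IsXOSOracle X) (hv : ∀ i, IsXOS (v i)) {H : ℝ}
    (hH : ∀ i, v i Finset.univ ≤ H) (i : Fin n) (T : Finset (Fin m)) (j : Fin m) :
    X i (v i) T j ≤ H := by
  have h := (hX.1 i _ (hv i) T).2.1 {j}
  rw [Finset.sum_singleton] at h
  exact (h.trans ((hv i).monotone (Finset.subset_univ _))).trans (hH i)

theorem sum_itemValue (hX : IsXOSOracle X) (hv : ∀ i, IsXOS (v i)) :
    ∑ j, itemValue ALG X v j = welfare v (ALG v) := by
  unfold itemValue welfare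
  rw [Finset.sum_comm]
  refine Finset.sum_congr rfl fun i _ => ?_
  rw [← (hX.1 i _ (hv i) (ALG v i)).2.2]
  simp only [supportValue, ← Finset.sum_filter]
  refine Finset.sum_congr (by ext; simp) fun _ _ => rfl

/-- An item given to nobody contributes nothing; otherwise exactly one bidder contributes. -/
theorem itemValue_eq (hALG : IsAllocationAlgorithm ALG) (hv : ∀ i, IsXOS (v i)) (j : Fin m) :
    itemValue ALG X v j = 0 ∨
      ∃ i, j ∈ ALG v i ∧ itemValue ALG X v j = X i (v i) (ALG v i) j := by
  by_cases h : ∃ i, j ∈ ALG v i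
  · obtain ⟨i, hi⟩ := h
    refine Or.inr ⟨i, hi, ?_⟩
    unfold itemValue
    rw [Finset.sum_eq_single i _ (by simp), supportValue, if_pos hi]
    exact fun k _ hk => if_neg fun hj => Finset.disjoint_left.1 (hALG.1 v hv k i hk) hj hi
  · exact Or.inl (Finset.sum_eq_zero fun i _ => if_neg (not_exists.1 h i))

theorem itemValue_mem_Icc (hALG : IsAllocationAlgorithm ALG) (hX : IsXOSOracle X)
    (hv : ∀ i, IsXOS (v i)) {H : ℝ} (h0 : 0 ≤ H) (hH : ∀ i, v i Finset.univ ≤ H) (j : Fin m) :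
    itemValue ALG X v j ∈ Set.Icc 0 H := by
  refine ⟨Finset.sum_nonneg fun i _ => supportValue_nonneg hX hv i j, ?_⟩
  rcases itemValue_eq (X := X) hALG hv j with h | ⟨i, -, h⟩
  · exact h.trans_le h0
  · rw [h]
    exact oracle_le hX hv hH i _ j

theorem surplus_nonneg {p : Fin m → ℝ} (i : Fin n) (j : Fin m) :
    0 ≤ surplus ALG X p i j v := by
  unfold surplus
  split_ifs
  · exact le_max_right _ _
  · exact le_rfl

theorem surplus_le (hX : IsXOSOracle X) (hv : ∀ i, IsXOS (v i)) {H : ℝ} (h0 : 0 ≤ H)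
    (hH : ∀ i, v i Finset.univ ≤ H) {p : Fin m → ℝ} (hp : ∀ j, 0 ≤ p j) (i : Fin n) (j : Fin m) :
    surplus ALG X p i j v ≤ H := by
  unfold surplus
  split_ifs
  · exact max_le (by linarith [oracle_le hX hv hH i (ALG v i) j, hp j]) h0
  · exact h0

theorem itemValue_sub_le (hALG : IsAllocationAlgorithm ALG) (hv : ∀ i, IsXOS (v i))
    {p : Fin m → ℝ} (hp : ∀ j, 0 ≤ p j) (j : Fin m) :
    itemValue ALG X v j - p j ≤ ∑ i, surplus ALG X p i j v := by
  rcases itemValue_eq (X := X) hALG hv j with h | ⟨i, hi, h⟩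
  · linarith [hp j, Finset.sum_nonneg fun i (_ : i ∈ Finset.univ) =>
      surplus_nonneg (ALG := ALG) (X := X) (v := v) (p := p) i j]
  · rw [h]
    refine le_trans ?_ (Finset.single_le_sum
      (fun i _ => surplus_nonneg (ALG := ALG) (X := X) (v := v) (p := p) i j) (Finset.mem_univ i))
    rw [surplus, if_pos hi]
    exact le_max_left _ _

end Support

/-! ### Budget-constrained demand queries -/

theorem liquid_nonneg {m : ℕ} {θ : BidderType m} (hθ : IsBidderType θ) (S : Finset (Fin m)) :
    0 ≤ liquid θ S :=
  le_min (hθ.1 ▸ hθ.2.1 (Finset.empty_subset S)) hθ.2.2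

theorem liquid_monotone {m : ℕ} {θ : BidderType m} (hθ : IsBidderType θ) : Monotone (liquid θ) :=
  fun _ _ h => min_le_min_right _ (hθ.2.1 h)

/-- A bundle bought in a budget-constrained demand query competes, in liquid value, with every
available bundle `T`, at the cost of a factor `2`: if the budget binds, her liquid value
is the whole budget, which is at least both `p(S)` and the liquid value of `T`; otherwise her
liquid value is her value, and she compared `S` with `∅` and, if affordable, with `T`. -/
theorem IsBCDQ.liquid_sub_add_le {m : ℕ} {θ : BidderType m} (hθ : IsBidderType θ)
    {U S T : Finset (Fin m)} {p : Fin m → ℝ} (hp : ∀ j, 0 ≤ p j) (hS : IsBCDQ θ U p S)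
    (hT : T ⊆ U) :
    liquid θ T - ∑ j ∈ T, p j + ∑ j ∈ S, p j ≤ 2 * liquid θ S := by
  have hpT : 0 ≤ ∑ j ∈ T, p j := Finset.sum_nonneg fun j _ => hp j
  have h1 : liquid θ T ≤ θ.2 := min_le_right _ _
  have h2 : liquid θ T ≤ θ.1 T := min_le_left _ _
  have h3 := hS.2.1
  have h4 := hS.2.2 ∅ (Finset.empty_subset U) (by simpa using hθ.2.2)
  rw [hθ.1, Finset.sum_empty] at h4
  have h5 := liquid_nonneg hθ S
  rcases le_total θ.2 (θ.1 S) with h | h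
  · have : liquid θ S = θ.2 := min_eq_right h
    linarith
  · have h6 : liquid θ S = θ.1 S := min_eq_left h
    rcases le_or_gt (∑ j ∈ T, p j) θ.2 with hb | hb
    · linarith [hS.2.2 T hT hb]
    · linarith

/-- A demand query on a set `U` of available items yields the surplus of all items of `U` that
`ALG` would give to the bidder under a profile in which she has the same type. -/
theorem IsBCDQ.sum_surplus_le {m n : ℕ}
    {ALG : (Fin n → SetValuation m) → Fin n → Finset (Fin m)}
    {X : Fin n → SetValuation m → Finset (Fin m) → Fin m → ℝ} (hX : IsXOSOracle X)
    {θ : BidderType m} (hθ : IsBidderType θ) (hx : IsXOS (liquid θ))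
    {U S : Finset (Fin m)} {p : Fin m → ℝ} (hp : ∀ j, 0 ≤ p j) (hS : IsBCDQ θ U p S)
    {i : Fin n} {v : Fin n → SetValuation m} (hv : v i = liquid θ) :
    ∑ j ∈ U, surplus ALG X p i j v + ∑ j ∈ S, p j ≤ 2 * liquid θ S := by
  classical
  set a := X i (v i) (ALG v i) with ha
  set T := (U ∩ ALG v i).filter fun j => p j ≤ a j with hT
  have hTU : T ⊆ U := (Finset.filter_subset _ _).trans Finset.inter_subset_left
  refine le_trans ?_ (hS.liquid_sub_add_le hθ hp hTU)
  have h1 : ∑ j ∈ T, a j ≤ liquid θ T := by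
    rw [ha, hv]
    exact (hX.1 i _ hx _).2.1 T
  have h2 : ∑ j ∈ U, surplus ALG X p i j v = ∑ j ∈ T, (a j - p j) := by
    rw [hT, Finset.sum_filter, ← Finset.filter_mem_eq_inter, Finset.sum_filter]
    refine Finset.sum_congr rfl fun j _ => ?_
    unfold surplus
    split_ifs with hj hle
    · exact max_eq_left (sub_nonneg.2 hle)
    · exact max_eq_right (sub_nonpos.2 (le_of_not_ge hle))
    · rfl
  rw [h2, Finset.sum_sub_distrib]
  linarith

/-! ### The course of the posted-price mechanism -/

/-- The items that are still available when bidder `k` arrives (irrelevant for a bidder who is not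
on the list). -/
def available {m n : ℕ} (br : Fin n → BidderType m → Finset (Fin m) → Finset (Fin m))
    (θ : Fin n → BidderType m) : List (Fin n) → Finset (Fin m) → Fin n → Finset (Fin m)
  | [], U => fun _ => U
  | i :: l, U => Function.update (available br θ l (U \ br i (θ i) U)) i U

/-- The items that are unsold at the end. -/
def unsold {m n : ℕ} (br : Fin n → BidderType m → Finset (Fin m) → Finset (Fin m))
    (θ : Fin n → BidderType m) : List (Fin n) → Finset (Fin m) → Finset (Fin m)
  | [], U => U
  | i :: l, U => unsold br θ l (U \ br i (θ i) U)

section Course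

variable {m n : ℕ} {br : Fin n → BidderType m → Finset (Fin m) → Finset (Fin m)}
  {θ : Fin n → BidderType m}

theorem unsold_subset (l : List (Fin n)) (U : Finset (Fin m)) : unsold br θ l U ⊆ U := by
  induction l generalizing U with
  | nil => exact subset_rfl
  | cons i l ih => exact (ih _).trans Finset.sdiff_subset

theorem unsold_subset_available (l : List (Fin n)) (U : Finset (Fin m)) (k : Fin n) :
    unsold br θ l U ⊆ available br θ l U k := by
  induction l generalizing U with
  | nil => exact subset_rfl
  | cons i l ih =>
    by_cases h : k = i
    · subst h
      simpa [available] using unsold_subset (br := br) (θ := θ) (k :: l) U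
    · simpa [available, h, unsold] using ih (U \ br i (θ i) U)

theorem postedPrice_of_notMem {l : List (Fin n)} {k : Fin n} (hk : k ∉ l)
    (U : Finset (Fin m)) : postedPrice br θ l U k = ∅ := by
  induction l generalizing U with
  | nil => rfl
  | cons i l ih =>
    rw [List.mem_cons, not_or] at hk
    simpa [postedPrice, hk.1] using ih hk.2 _

theorem postedPrice_of_mem {l : List (Fin n)} {k : Fin n} (hk : k ∈ l) (U : Finset (Fin m)) :
    postedPrice br θ l U k = br k (θ k) (available br θ l U k) := by
  induction l generalizing U with
  | nil => simp at hk
  | cons i l ih =>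
    by_cases h : k = i
    · subst h
      simp [postedPrice, available]
    · simpa [postedPrice, available, h] using ih (by simpa [h] using hk) _

/-- What is available to a bidder does not depend on her own type. -/
theorem available_update (l : List (Fin n)) (hl : l.Nodup) (U : Finset (Fin m))
    {k : Fin n} (hk : k ∈ l) (t : BidderType m) :
    available br (Function.update θ k t) l U k = available br θ l U k := by
  induction l generalizing U with
  | nil => simp at hk
  | cons i l ih =>
    by_cases h : k = i
    · subst h
      simp [available]
    · simpa [available, h, Function.update_of_ne (Ne.symm h)]
        using ih hl.of_cons _ (by simpa [h] using hk)

theorem sum_price_postedPrice (p : Fin m → ℝ) {l : List (Fin n)} (hl : l.Nodup)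
    (hbr : ∀ i U, br i (θ i) U ⊆ U) (U : Finset (Fin m)) :
    ∑ k, ∑ j ∈ postedPrice br θ l U k, p j =
      ∑ j ∈ U, p j - ∑ j ∈ unsold br θ l U, p j := by
  induction l generalizing U with
  | nil => simp [postedPrice, unsold]
  | cons i l ih =>
    have hi : i ∉ l := (List.nodup_cons.1 hl).1
    have h := ih hl.of_cons (U \ br i (θ i) U)
    rw [← Finset.add_sum_erase _ _ (Finset.mem_univ i), postedPrice_of_notMem hi,
      Finset.sum_empty, zero_add] at h
    rw [← Finset.add_sum_erase _ _ (Finset.mem_univ i), unsold]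
    have h2 : ∑ k ∈ Finset.univ.erase i, ∑ j ∈ postedPrice br θ (i :: l) U k, p j =
        ∑ k ∈ Finset.univ.erase i, ∑ j ∈ postedPrice br θ l (U \ br i (θ i) U) k, p j :=
      Finset.sum_congr rfl fun k hk => by
        simp [postedPrice, Function.update_of_ne (Finset.ne_of_mem_erase hk)]
    rw [h2, h, postedPrice, Function.update_self, ← Finset.sum_sdiff (hbr i U)]
    ring

end Course

/-! ### Measurability -/

theorem measurable_of_fibers {α β : Type*} [MeasurableSpace α] [Fintype β] {F : α → β}
    (hF : ∀ b, MeasurableSet {a | F a = b}) {g : β → α → ℝ} (hg : ∀ b, Measurable (g b)) :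
    Measurable fun a => g (F a) a := by
  classical
  have : (fun a => g (F a) a) = fun a => ∑ b, if F a = b then g b a else 0 := by
    ext a
    simp
  rw [this]
  exact Finset.measurable_sum _ fun b _ => Measurable.ite (hF b) (hg b) measurable_const

theorem measurable_liquid {m : ℕ} : Measurable (liquid : BidderType m → SetValuation m) := by
  unfold liquid
  fun_prop

theorem measurable_liquidProfile {m n : ℕ} :
    Measurable (liquidProfile : (Fin n → BidderType m) → Fin n → SetValuation m) :=
  measurable_pi_lambda _ fun i => measurable_liquid.comp (measurable_pi_apply i)

section Measurability

variable {m n : ℕ} {ALG : (Fin n → SetValuation m) → Fin n → Finset (Fin m)}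
  {X : Fin n → SetValuation m → Finset (Fin m) → Fin m → ℝ}

theorem measurable_supportValue (hALG : IsAllocationAlgorithm ALG) (hX : IsXOSOracle X)
    (i : Fin n) (j : Fin m) : Measurable (supportValue ALG X i j) := by
  classical
  exact measurable_of_fibers (F := fun v => ALG v i) (hALG.2 i)
    (g := fun S v => if j ∈ S then X i (v i) S j else 0) fun S =>
      Measurable.ite (MeasurableSet.const _) ((hX.2 i S j).comp (measurable_pi_apply i))
        measurable_const

theorem measurable_itemValue (hALG : IsAllocationAlgorithm ALG) (hX : IsXOSOracle X)
    (j : Fin m) : Measurable fun v => itemValue ALG X v j :=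
  Finset.measurable_sum _ fun i _ => measurable_supportValue hALG hX i j

theorem measurable_surplus (hALG : IsAllocationAlgorithm ALG) (hX : IsXOSOracle X)
    (p : Fin m → ℝ) (i : Fin n) (j : Fin m) : Measurable (surplus ALG X p i j) := by
  classical
  exact measurable_of_fibers (F := fun v => ALG v i) (hALG.2 i)
    (g := fun S v => if j ∈ S then max (X i (v i) S j - p j) 0 else 0) fun S =>
      Measurable.ite (MeasurableSet.const _)
        ((((hX.2 i S j).comp (measurable_pi_apply i)).sub_const _).max measurable_const)
        measurable_const

variable {br : Fin n → BidderType m → Finset (Fin m) → Finset (Fin m)}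

theorem measurableSet_br (hbr : ∀ i U S, MeasurableSet {θ | br i θ U = S}) (i : Fin n)
    (U S : Finset (Fin m)) : MeasurableSet {θ : Fin n → BidderType m | br i (θ i) U = S} :=
  (measurable_pi_apply i : Measurable fun θ : Fin n → BidderType m => θ i) (hbr i U S)

theorem measurableSet_available (hbr : ∀ i U S, MeasurableSet {θ | br i θ U = S})
    (l : List (Fin n)) (U : Finset (Fin m)) (k : Fin n) (S : Finset (Fin m)) :
    MeasurableSet {θ | available br θ l U k = S} := by
  induction l generalizing U with
  | nil => exact MeasurableSet.const (U = S)
  | cons i l ih =>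
    by_cases h : k = i
    · subst h
      simp [available]
    · have : {θ | available br θ (i :: l) U k = S} =
          ⋃ T, {θ | br i (θ i) U = T} ∩ {θ | available br θ l (U \ T) k = S} := by
        ext θ
        simp [available, h]
      rw [this]
      exact MeasurableSet.iUnion fun T =>
        (measurableSet_br hbr i U T).inter (ih (U \ T))

theorem measurableSet_unsold (hbr : ∀ i U S, MeasurableSet {θ | br i θ U = S})
    (l : List (Fin n)) (U S : Finset (Fin m)) :
    MeasurableSet {θ | unsold br θ l U = S} := by
  induction l generalizing U with
  | nil => exact MeasurableSet.const (U = S)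
  | cons i l ih =>
    have : {θ | unsold br θ (i :: l) U = S} =
        ⋃ T, {θ | br i (θ i) U = T} ∩ {θ | unsold br θ l (U \ T) = S} := by
      ext θ
      simp [unsold]
    rw [this]
    exact MeasurableSet.iUnion fun T =>
      (measurableSet_br hbr i U T).inter (ih (U \ T))

theorem measurableSet_postedPrice (hbr : ∀ i U S, MeasurableSet {θ | br i θ U = S})
    (l : List (Fin n)) (U : Finset (Fin m)) (k : Fin n) (S : Finset (Fin m)) :
    MeasurableSet {θ | postedPrice br θ l U k = S} := by
  by_cases hk : k ∈ l
  · have : {θ | postedPrice br θ l U k = S} =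
        ⋃ T, {θ | available br θ l U k = T} ∩ {θ | br k (θ k) T = S} := by
      ext θ
      simp [postedPrice_of_mem hk]
    rw [this]
    exact MeasurableSet.iUnion fun T =>
      (measurableSet_available hbr l U k T).inter (measurableSet_br hbr k T S)
  · simp [postedPrice_of_notMem hk]

theorem measurable_welfare_outcome (hbr : ∀ i U S, MeasurableSet {θ | br i θ U = S})
    (π : Equiv.Perm (Fin n)) :
    Measurable fun θ : Fin n → BidderType m => welfare (liquidProfile θ) (outcome br π θ) :=
  Finset.measurable_sum _ fun i _ =>
    measurable_of_fibers (F := fun θ => outcome br π θ i)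
      (fun S => measurableSet_postedPrice hbr _ _ i S) (g := fun S θ => liquid (θ i) S) fun S =>
        (measurable_pi_apply S).comp (measurable_liquid.comp (measurable_pi_apply i))

end Measurability

/-! ### Resampling the types of the other bidders -/

/-- Exchanging one coordinate of two independent profiles preserves their joint law. -/
theorem measurePreserving_exchange {ι α : Type*} [Fintype ι] [DecidableEq ι] [MeasurableSpace α]
    (τ : ι → Measure α) [∀ i, IsProbabilityMeasure (τ i)] (i : ι) :
    MeasurePreserving (fun z : (ι → α) × (ι → α) =>
        (Function.update z.1 i (z.2 i), Function.update z.2 i (z.1 i)))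
      ((Measure.pi τ).prod (Measure.pi τ)) ((Measure.pi τ).prod (Measure.pi τ)) := by
  have hE := measurePreserving_arrowProdEquivProdArrow α α ι τ τ
  have hs : MeasurePreserving (fun (w : ι → α × α) k => (if k = i then Prod.swap else id) (w k))
      (Measure.pi fun k => (τ k).prod (τ k)) (Measure.pi fun k => (τ k).prod (τ k)) := by
    refine measurePreserving_pi _ _ (f := fun k => if k = i then Prod.swap else id) fun k => ?_
    split_ifs
    · exact Measure.measurePreserving_swap
    · exact MeasurePreserving.id _
  convert hE.comp (hs.comp (hE.symm _)) using 1
  ext z k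
  · by_cases h : k = i
    · subst h
      simp [MeasurableEquiv.arrowProdEquivProdArrow, Equiv.arrowProdEquivProdArrow]
    · simp [h, MeasurableEquiv.arrowProdEquivProdArrow, Equiv.arrowProdEquivProdArrow]
  · by_cases h : k = i
    · subst h
      simp [MeasurableEquiv.arrowProdEquivProdArrow, Equiv.arrowProdEquivProdArrow]
    · simp [h, MeasurableEquiv.arrowProdEquivProdArrow, Equiv.arrowProdEquivProdArrow]

/-- A function that ignores coordinate `i` is independent of a function of coordinate `i` and of
fresh samples of the other coordinates. -/
theorem integral_mul_resample {ι α : Type*} [Fintype ι] [DecidableEq ι] [MeasurableSpace α]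
    (τ : ι → Measure α) [∀ i, IsProbabilityMeasure (τ i)] (i : ι) {g f : (ι → α) → ℝ}
    (hg : Measurable g) (hf : Measurable f) (hgi : ∀ θ t, g (Function.update θ i t) = g θ) :
    ∫ z, g z.1 * f (Function.update z.2 i (z.1 i)) ∂((Measure.pi τ).prod (Measure.pi τ)) =
      (∫ θ, g θ ∂(Measure.pi τ)) * ∫ θ, f θ ∂(Measure.pi τ) := by
  have h := measurePreserving_exchange τ i
  have hgf : Measurable fun z : (ι → α) × (ι → α) => g z.1 * f z.2 :=
    (hg.comp measurable_fst).mul (hf.comp measurable_snd)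
  rw [← integral_prod_mul]
  conv_rhs => rw [← h.map_eq]
  rw [integral_map h.measurable.aemeasurable hgf.aestronglyMeasurable]
  simp only [hgi]

/-! ### The welfare of given prices -/

section Welfare

variable {m n : ℕ} {ALG : (Fin n → SetValuation m) → Fin n → Finset (Fin m)}
  {X : Fin n → SetValuation m → Finset (Fin m) → Fin m → ℝ}
  {br : Fin n → BidderType m → Finset (Fin m) → Finset (Fin m)}

/-- For two type profiles, the mechanism on the first compared with `ALG` on the profiles in which
one bidder keeps her type and the others have the types of the second: revenue plus surplus is
at most twice the liquid welfare. -/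
theorem revenue_add_surplus_le (hX : IsXOSOracle X) {p : Fin m → ℝ} (hp : ∀ j, 0 ≤ p j)
    (hbr : IsBCDQRule p br) (π : Equiv.Perm (Fin n)) {θ : Fin n → BidderType m}
    (hθ : ∀ i, IsBidderType (θ i) ∧ IsXOS (liquid (θ i))) (θ' : Fin n → BidderType m) :
    (∑ j, p j - ∑ j ∈ unsold br θ (List.ofFn π) Finset.univ, p j) +
        ∑ i, ∑ j ∈ available br θ (List.ofFn π) Finset.univ i,
          surplus ALG X p i j (liquidProfile (Function.update θ' i (θ i))) ≤
      2 * welfare (liquidProfile θ) (outcome br π θ) := by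
  have hnodup : (List.ofFn π).Nodup := List.nodup_ofFn.2 π.injective
  have hmem : ∀ i, i ∈ List.ofFn π := fun i => List.mem_ofFn.2 (π.surjective i)
  have hB : ∀ i U, IsBCDQ (θ i) U p (br i (θ i) U) := fun i U => hbr.1 i _ (hθ i).1 U
  rw [← sum_price_postedPrice p hnodup (fun i U => (hB i U).1), ← Finset.sum_add_distrib, welfare,
    Finset.mul_sum]
  refine Finset.sum_le_sum fun i _ => ?_
  rw [add_comm, outcome, postedPrice_of_mem (hmem i)]
  exact (hB i _).sum_surplus_le hX (hθ i).1 (hθ i).2 hp (by simp [liquidProfile])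

variable {τ : Fin n → Measure (BidderType m)} [∀ i, IsProbabilityMeasure (τ i)] {H : ℝ}

theorem ae_profile
    (hτ : ∀ i, ∀ᵐ θ ∂(τ i), IsBidderType θ ∧ IsXOS (liquid θ) ∧ liquid θ Finset.univ ≤ H) :
    ∀ᵐ θ ∂(Measure.pi τ), ∀ i,
      IsBidderType (θ i) ∧ IsXOS (liquid (θ i)) ∧ liquid (θ i) Finset.univ ≤ H :=
  Filter.eventually_all.2 fun i => Measure.tendsto_eval_ae_ae.eventually (hτ i)

theorem integrable_itemValue (hALG : IsAllocationAlgorithm ALG) (hX : IsXOSOracle X)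
    (hτ : ∀ i, ∀ᵐ θ ∂(τ i), IsBidderType θ ∧ IsXOS (liquid θ) ∧ liquid θ Finset.univ ≤ H)
    (h0 : 0 ≤ H) (j : Fin m) :
    Integrable (fun θ => itemValue ALG X (liquidProfile θ) j) (Measure.pi τ) := by
  refine Integrable.of_mem_Icc 0 H
    ((measurable_itemValue hALG hX j).comp measurable_liquidProfile).aemeasurable ?_
  filter_upwards [ae_profile hτ] with θ hθ
  exact itemValue_mem_Icc hALG hX (fun i => (hθ i).2.1) h0 (fun i => (hθ i).2.2) j

theorem integrable_welfare_outcome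
    (hτ : ∀ i, ∀ᵐ θ ∂(τ i), IsBidderType θ ∧ IsXOS (liquid θ) ∧ liquid θ Finset.univ ≤ H)
    (hbr : ∀ i U S, MeasurableSet {θ | br i θ U = S}) (π : Equiv.Perm (Fin n)) :
    Integrable (fun θ => welfare (liquidProfile θ) (outcome br π θ)) (Measure.pi τ) := by
  refine Integrable.of_mem_Icc 0 (∑ _i : Fin n, H)
    (measurable_welfare_outcome hbr π).aemeasurable ?_
  filter_upwards [ae_profile hτ] with θ hθ
  exact ⟨Finset.sum_nonneg fun i _ => liquid_nonneg (hθ i).1 _, Finset.sum_le_sum fun i _ =>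
    (liquid_monotone (hθ i).1 (Finset.subset_univ _)).trans (hθ i).2.2⟩

/-- Item by item: an item sold with probability `1 - c j` contributes its price times `1 - c j` to
the revenue, and its value minus its price times `c j` to the utilities of the bidders. -/
theorem exists_sum_le_welfare_outcome (hALG : IsAllocationAlgorithm ALG) (hX : IsXOSOracle X)
    (hτ : ∀ i, ∀ᵐ θ ∂(τ i), IsBidderType θ ∧ IsXOS (liquid θ) ∧ liquid θ Finset.univ ≤ H)
    (h0 : 0 ≤ H) {p : Fin m → ℝ} (hp : ∀ j, 0 ≤ p j) (hbr : IsBCDQRule p br)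
    (π : Equiv.Perm (Fin n)) :
    ∃ c : Fin m → ℝ, (∀ j, c j ∈ Set.Icc 0 1) ∧
      ∑ j, ((1 - c j) * p j +
          c j * ((∫ θ, itemValue ALG X (liquidProfile θ) j ∂(Measure.pi τ)) - p j)) ≤
        2 * ∫ θ, welfare (liquidProfile θ) (outcome br π θ) ∂(Measure.pi τ) := by
  classical
  set μ := Measure.pi τ with hμ
  set l := List.ofFn π with hl
  have hnodup : l.Nodup := List.nodup_ofFn.2 π.injective
  have hmem : ∀ i, i ∈ l := fun i => List.mem_ofFn.2 (π.surjective i)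
  let u : Fin m → (Fin n → BidderType m) → ℝ :=
    fun j θ => if j ∈ unsold br θ l Finset.univ then 1 else 0
  let g : Fin n → Fin m → (Fin n → BidderType m) → ℝ :=
    fun i j θ => if j ∈ available br θ l Finset.univ i then 1 else 0
  let f : Fin n → Fin m → (Fin n → BidderType m) → ℝ :=
    fun i j θ => surplus ALG X p i j (liquidProfile θ)
  have hu_mem : ∀ j θ, u j θ ∈ Set.Icc (0 : ℝ) 1 := fun j θ => by
    by_cases h : j ∈ unsold br θ l Finset.univ <;> simp [u, h]
  have hg_mem : ∀ i j θ, g i j θ ∈ Set.Icc (0 : ℝ) 1 := fun i j θ => by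
    by_cases h : j ∈ available br θ l Finset.univ i <;> simp [g, h]
  have hu : ∀ j, Measurable (u j) := fun j =>
    measurable_of_fibers (F := fun θ => unsold br θ l Finset.univ)
      (measurableSet_unsold hbr.2 l _) (g := fun S _ => if j ∈ S then 1 else 0)
      fun _ => measurable_const
  have hg : ∀ i j, Measurable (g i j) := fun i j =>
    measurable_of_fibers (F := fun θ => available br θ l Finset.univ i)
      (measurableSet_available hbr.2 l _ i) (g := fun S _ => if j ∈ S then 1 else 0)
      fun _ => measurable_const
  have hf : ∀ i j, Measurable (f i j) := fun i j =>
    (measurable_surplus hALG hX p i j).comp measurable_liquidProfile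
  have hf_mem : ∀ᵐ θ ∂μ, ∀ i j, f i j θ ∈ Set.Icc 0 H := by
    filter_upwards [ae_profile hτ] with θ hθ i j
    exact ⟨surplus_nonneg i j,
      surplus_le hX (fun i => (hθ i).2.1) h0 (fun i => (hθ i).2.2) hp i j⟩
  have hu_int : ∀ j, Integrable (u j) μ := fun j =>
    Integrable.of_mem_Icc 0 1 (hu j).aemeasurable (.of_forall (hu_mem j))
  have hg_int : ∀ i j, Integrable (g i j) μ := fun i j =>
    Integrable.of_mem_Icc 0 1 (hg i j).aemeasurable (.of_forall (hg_mem i j))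
  have hf_int : ∀ i j, Integrable (f i j) μ := fun i j =>
    Integrable.of_mem_Icc 0 H (hf i j).aemeasurable (hf_mem.mono fun θ h => h i j)
  have hgf_int : ∀ i j, Integrable
      (fun z : (Fin n → BidderType m) × (Fin n → BidderType m) =>
        g i j z.1 * f i j (Function.update z.2 i (z.1 i))) (μ.prod μ) := fun i j => by
    have h := measurePreserving_exchange τ i
    have h' : (fun z : (Fin n → BidderType m) × (Fin n → BidderType m) =>
        g i j z.1 * f i j (Function.update z.2 i (z.1 i))) =
        (fun z => g i j z.1 * f i j z.2) ∘ fun z =>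
          (Function.update z.1 i (z.2 i), Function.update z.2 i (z.1 i)) := by
      ext z
      simp [g, available_update l hnodup _ (hmem i)]
    rw [h']
    exact h.integrable_comp_of_integrable ((hg_int i j).mul_prod (hf_int i j))
  have hW := integrable_welfare_outcome hτ hbr.2 π
  have key : ∀ᵐ z ∂(μ.prod μ), ∑ j, (1 - u j z.1) * p j +
      ∑ i, ∑ j, g i j z.1 * f i j (Function.update z.2 i (z.1 i)) ≤
        2 * welfare (liquidProfile z.1) (outcome br π z.1) := by
    filter_upwards [Measure.quasiMeasurePreserving_fst.ae (ae_profile hτ)] with z hz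
    refine le_of_eq_of_le ?_ (revenue_add_surplus_le (ALG := ALG) hX hp hbr π
      (fun i => ⟨(hz i).1, (hz i).2.1⟩) z.2)
    congr 1
    · simp [u, sub_mul, ← hl]
    · simp [g, f, ← hl]
  have hR_int : ∀ j, Integrable (fun z : (Fin n → BidderType m) × (Fin n → BidderType m) =>
      (1 - u j z.1) * p j) (μ.prod μ) := fun j =>
    (((integrable_const 1).sub (hu_int j)).mul_const (p j)).comp_fst μ
  have hint := integral_mono_ae
    ((integrable_finsetSum _ fun j _ => hR_int j).add
      (integrable_finsetSum _ fun i _ => integrable_finsetSum _ fun j _ => hgf_int i j))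
    ((hW.const_mul 2).comp_fst μ) key
  simp only [Pi.add_apply] at hint
  rw [integral_add (integrable_finsetSum _ fun j _ => hR_int j)
      (integrable_finsetSum _ fun i _ => integrable_finsetSum _ fun j _ => hgf_int i j),
    integral_finsetSum _ fun j _ => hR_int j,
    integral_finsetSum _ fun i _ => integrable_finsetSum _ fun j _ => hgf_int i j,
    integral_fun_fst (μ := μ) (ν := μ)
      (fun θ => 2 * welfare (liquidProfile θ) (outcome br π θ)),
    integral_const_mul] at hint
  have e1 : ∀ j, ∫ z, (1 - u j z.1) * p j ∂(μ.prod μ) = (1 - ∫ θ, u j θ ∂μ) * p j := fun j => by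
    rw [integral_fun_fst (μ := μ) (ν := μ) (fun θ => (1 - u j θ) * p j), integral_mul_const,
      integral_sub (integrable_const 1) (hu_int j)]
    simp
  have e2 : ∀ i, ∫ z, ∑ j, g i j z.1 * f i j (Function.update z.2 i (z.1 i)) ∂(μ.prod μ) =
      ∑ j, (∫ θ, g i j θ ∂μ) * ∫ θ, f i j θ ∂μ := fun i => by
    rw [integral_finsetSum _ fun j _ => hgf_int i j]
    refine Finset.sum_congr rfl fun j _ => integral_mul_resample τ i (hg i j) (hf i j) ?_
    intro θ t
    simp [g, available_update l hnodup _ (hmem i)]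
  simp only [e1, e2] at hint
  refine ⟨fun j => ∫ θ, u j θ ∂μ, fun j => ⟨integral_nonneg fun θ => (hu_mem j θ).1, ?_⟩, ?_⟩
  · simpa using integral_mono (hu_int j) (integrable_const (1 : ℝ)) fun θ => (hu_mem j θ).2
  · refine le_trans ?_ (hint.trans_eq (by simp))
    rw [Finset.sum_add_distrib]
    refine add_le_add_right ?_ _
    rw [Finset.sum_comm]
    refine Finset.sum_le_sum fun j _ => ?_
    -- what is unsold at the end was available to every bidder
    have hug : ∀ i, ∫ θ, u j θ ∂μ ≤ ∫ θ, g i j θ ∂μ := fun i =>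
      integral_mono (hu_int j) (hg_int i j) fun θ => by
        by_cases h : j ∈ unsold br θ l Finset.univ
        · simp [u, g, h, unsold_subset_available l _ i h]
        · simpa [u, h] using (hg_mem i j θ).1
    have hq : (∫ θ, itemValue ALG X (liquidProfile θ) j ∂μ) - p j ≤ ∑ i, ∫ θ, f i j θ ∂μ := by
      rw [← integral_finsetSum _ fun i _ => hf_int i j]
      have hqi := integrable_itemValue hALG hX hτ h0 j
      have : (∫ θ, itemValue ALG X (liquidProfile θ) j ∂μ) - p j =
          ∫ θ, (itemValue ALG X (liquidProfile θ) j - p j) ∂μ := by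
        rw [integral_sub hqi (integrable_const _)]
        simp [hμ]
      rw [this]
      refine integral_mono_ae (hqi.sub (integrable_const _))
        (integrable_finsetSum _ fun i _ => hf_int i j) ?_
      filter_upwards [ae_profile hτ] with θ hθ
      exact itemValue_sub_le hALG (fun i => (hθ i).2.1) hp j
    refine (mul_le_mul_of_nonneg_left hq (integral_nonneg fun θ => (hu_mem j θ).1)).trans ?_
    rw [Finset.mul_sum]
    exact Finset.sum_le_sum fun i _ => mul_le_mul_of_nonneg_right (hug i)
      (integral_nonneg fun θ => surplus_nonneg i j)

/-- Prices close to half of the expected contributions of the items to the welfare of `ALG` are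
good: then both the price and the value minus the price are about half of the value,
whether the item is sold or not. -/
theorem goodPrices_of_abs_sub_le (hALG : IsAllocationAlgorithm ALG) (hX : IsXOSOracle X)
    (hτ : ∀ i, ∀ᵐ θ ∂(τ i), IsBidderType θ ∧ IsXOS (liquid θ) ∧ liquid θ Finset.univ ≤ H)
    (h0 : 0 ≤ H) {p : Fin m → ℝ} (hp : ∀ j, 0 ≤ p j) {ε η : ℝ} (hη : m * η ≤ 4 * ε)
    (hpη : ∀ j,
      |2 * p j - ∫ θ, itemValue ALG X (liquidProfile θ) j ∂(Measure.pi τ)| ≤ η) :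
    GoodPrices τ ALG ε p := by
  refine ⟨hp, fun π br hbr => ?_⟩
  obtain ⟨c, hc, hsum⟩ := exists_sum_le_welfare_outcome hALG hX hτ h0 hp hbr π
  have hOPT : ∫ θ, welfare (liquidProfile θ) (ALG (liquidProfile θ)) ∂(Measure.pi τ) =
      ∑ j, ∫ θ, itemValue ALG X (liquidProfile θ) j ∂(Measure.pi τ) := by
    rw [← integral_finsetSum _ fun j _ => integrable_itemValue hALG hX hτ h0 j]
    refine integral_congr_ae ?_
    filter_upwards [ae_profile hτ] with θ hθ
    exact (sum_itemValue hX fun i => (hθ i).2.1).symm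
  rw [hOPT]
  have h : ∑ j, ((∫ θ, itemValue ALG X (liquidProfile θ) j ∂(Measure.pi τ)) / 2 - η / 2) ≤
      ∑ j, ((1 - c j) * p j +
        c j * ((∫ θ, itemValue ALG X (liquidProfile θ) j ∂(Measure.pi τ)) - p j)) := by
    refine Finset.sum_le_sum fun j _ => ?_
    have h1 := abs_le.1 (hpη j)
    nlinarith [mul_nonneg (hc j).1 (sub_nonneg.2 h1.2),
      mul_nonneg (sub_nonneg.2 (hc j).2) (sub_nonneg.2 h1.1)]
  rw [Finset.sum_sub_distrib, ← Finset.sum_div] at h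
  simp only [Finset.sum_const, Finset.card_univ, Fintype.card_fin, nsmul_eq_mul] at h
  linarith

end Welfare

/-! ### Concentration of empirical means -/

theorem measureReal_sum_sub_ge_le {Ω : Type*} [MeasurableSpace Ω] (μ : Measure Ω)
    [IsProbabilityMeasure μ] {f : Ω → ℝ} (hf : Measurable f) {a b : ℝ}
    (hb : ∀ᵐ x ∂μ, f x ∈ Set.Icc a b) (N : ℕ) {s : ℝ} (hs : 0 ≤ s) :
    (Measure.infinitePi fun _ : ℕ => μ).real
        {ω | s ≤ ∑ k ∈ Finset.range N, (f (ω k) - ∫ x, f x ∂μ)} ≤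
      Real.exp (-s ^ 2 / (2 * N * ((b - a) / 2) ^ 2)) := by
  have hmp : ∀ k : ℕ, MeasurePreserving (Function.eval k : (ℕ → Ω) → Ω)
      (Measure.infinitePi fun _ : ℕ => μ) μ := fun k =>
    measurePreserving_eval_infinitePi (fun _ : ℕ => μ) k
  have hind : ProbabilityTheory.iIndepFun
      (fun (k : ℕ) (ω : ℕ → Ω) => f (ω k) - ∫ x, f x ∂μ) (Measure.infinitePi fun _ : ℕ => μ) :=
    ProbabilityTheory.iIndepFun_infinitePi (P := fun _ : ℕ => μ)
      (X := fun _ x => f x - ∫ x, f x ∂μ) fun _ => hf.sub_const _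
  have h := ProbabilityTheory.HasSubgaussianMGF.measure_sum_range_ge_le_of_iIndepFun hind
    (n := N) (c := (‖b - a‖₊ / 2) ^ 2) (fun k _ => by
      have hk := ProbabilityTheory.hasSubgaussianMGF_of_mem_Icc
        (hf.comp (hmp k).measurable).aemeasurable ((hmp k).quasiMeasurePreserving.ae hb)
      have hmean : ∫ ω, (f ∘ Function.eval k) ω ∂(Measure.infinitePi fun _ : ℕ => μ) =
          ∫ x, f x ∂μ := by
        conv_rhs => rw [← (hmp k).map_eq]
        rw [integral_map (hmp k).measurable.aemeasurable hf.aestronglyMeasurable]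
        rfl
      rw [hmean] at hk
      exact hk) hs
  refine h.trans_eq ?_
  congr 2
  simp [div_pow]

theorem measure_abs_sum_sub_ge_le {Ω : Type*} [MeasurableSpace Ω] (μ : Measure Ω)
    [IsProbabilityMeasure μ] {f : Ω → ℝ} (hf : Measurable f) {H : ℝ}
    (hb : ∀ᵐ x ∂μ, f x ∈ Set.Icc 0 H) (N : ℕ) {s : ℝ} (hs : 0 ≤ s) :
    (Measure.infinitePi fun _ : ℕ => μ)
        {ω | s ≤ |∑ k ∈ Finset.range N, f (ω k) - N * ∫ x, f x ∂μ|} ≤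
      ENNReal.ofReal (2 * Real.exp (-s ^ 2 / (2 * N * (H / 2) ^ 2))) := by
  have h1 := measureReal_sum_sub_ge_le μ hf hb N hs
  have h2 := measureReal_sum_sub_ge_le μ hf.neg (a := -H) (b := 0)
    (hb.mono fun x hx => ⟨neg_le_neg hx.2, neg_nonpos.2 hx.1⟩) N hs
  rw [sub_zero] at h1
  rw [sub_neg_eq_add, zero_add] at h2
  rw [← ENNReal.ofReal_toReal (measure_ne_top _ _)]
  refine ENNReal.ofReal_le_ofReal ?_
  refine le_trans ?_ ((measureReal_union_le _ _).trans ((add_le_add h1 h2).trans_eq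
    (two_mul _).symm))
  refine measureReal_mono fun ω hω => ?_
  rcases le_abs.1 (show s ≤ |_| from hω) with h | h
  · left
    simpa [Finset.sum_sub_distrib] using h
  · right
    simp only [Set.mem_ofPred_eq, Pi.neg_apply, integral_neg, Finset.sum_sub_distrib,
      Finset.sum_neg_distrib, Finset.sum_const, Finset.card_range, nsmul_eq_mul]
    linarith

/-- The number of samples that the program draws, before rounding up, where `L` is the number of doublings that raise
`δ` to at least `1`. -/
noncomputable def sampleBound (m : ℕ) (ε H : ℝ) (L : ℕ) : ℝ :=
  ((m + 1) * H / ε) * ((m + 1) * H / ε) * (m + 1 + L)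

/-- Hoeffding's inequality with a union bound over the items. -/
theorem measure_exists_abs_sum_sub_ge_le {Ω : Type*} [MeasurableSpace Ω] (μ : Measure Ω)
    [IsProbabilityMeasure μ] {m : ℕ} {q : Ω → Fin m → ℝ} (hq : ∀ j, Measurable fun x => q x j)
    {ε δ H : ℝ} (hε : 0 < ε) (hH : 0 < H)
    (hb : ∀ᵐ x ∂μ, ∀ j, q x j ∈ Set.Icc 0 H) {L N : ℕ} (hL : 1 ≤ 2 ^ L * δ)
    (hN : sampleBound m ε H L ≤ N) :
    (Measure.infinitePi fun _ : ℕ => μ)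
        {ω | ∃ j, N * (4 * ε / (m + 1)) ≤
          |∑ k ∈ Finset.range N, q (ω k) j - N * ∫ x, q x j ∂μ|} ≤ ENNReal.ofReal δ := by
  have hm : (0 : ℝ) < m + 1 := by positivity
  have hN0 : (0 : ℝ) < N := lt_of_lt_of_le (by unfold sampleBound; positivity) hN
  set s : ℝ := N * (4 * ε / (m + 1)) with hs
  have hexp : m * (2 * Real.exp (-s ^ 2 / (2 * N * (H / 2) ^ 2))) ≤ δ := by
    have e : -s ^ 2 / (2 * N * (H / 2) ^ 2) = -(32 * (N / ((m + 1) * H / ε) ^ 2)) := by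
      rw [hs]
      field_simp
      ring
    have h1 : (m + 1 + L : ℝ) ≤ N / ((m + 1) * H / ε) ^ 2 := by
      rw [le_div_iff₀ (by positivity)]
      refine le_trans (le_of_eq ?_) hN
      rw [sampleBound]
      ring
    -- the factor `32` is not needed
    have h2 : -s ^ 2 / (2 * N * (H / 2) ^ 2) ≤ -(m + 1 + L) := by
      rw [e]
      have : (0 : ℝ) ≤ m + 1 + L := by positivity
      linarith
    have h3 : Real.exp (-s ^ 2 / (2 * N * (H / 2) ^ 2)) ≤ (1 / 2) ^ (m + 1 + L) := by
      refine (Real.exp_le_exp.2 h2).trans ?_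
      have : -((m : ℝ) + 1 + L) = ((m + 1 + L : ℕ) : ℝ) * (-1) := by
        push_cast
        ring
      rw [this, Real.exp_nat_mul]
      refine pow_le_pow_left₀ (Real.exp_pos _).le ?_ _
      rw [Real.exp_neg, one_div]
      exact inv_anti₀ two_pos (by linarith [Real.add_one_le_exp (1 : ℝ)])
    have h4 : (m : ℝ) ≤ 2 ^ m := by exact_mod_cast Nat.lt_two_pow_self.le
    calc m * (2 * Real.exp (-s ^ 2 / (2 * N * (H / 2) ^ 2)))
        ≤ 2 ^ m * (2 * (1 / 2) ^ (m + 1 + L)) := by gcongr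
      _ = (1 / 2) ^ L := by
          rw [pow_add, pow_succ, ← mul_assoc, ← mul_assoc, mul_comm (2 ^ m : ℝ) 2,
            ← mul_assoc, mul_assoc 2, ← mul_pow]
          norm_num
      _ ≤ δ := by
          rw [one_div, inv_pow]
          exact (inv_le_iff_one_le_mul₀' (by positivity)).2 hL
  rw [Set.ofPred_exists]
  refine (measure_iUnion_fintype_le _ _).trans ?_
  refine (Finset.sum_le_sum fun j _ => measure_abs_sum_sub_ge_le μ (hq j)
    (hb.mono fun x hx => hx j) N (by positivity)).trans ?_
  rw [Finset.sum_const, Finset.card_univ, Fintype.card_fin, nsmul_eq_mul,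
    ← ENNReal.ofReal_natCast, ← ENNReal.ofReal_mul (by positivity)]
  exact ENNReal.ofReal_le_ofReal hexp

/-! ### Running programs -/

/-- From the memory `s`, the program `c` finishes in at most `T` steps, with the memory `s'`,
whatever remains to be run after it. -/
def Runs {m n : ℕ} (A : Access m n) (c : Prog) (T : ℕ) (s s' : Memory) : Prop :=
  ∃ t ≤ T, ∀ K, (step A)^[t] (c :: K, s) = (K, s')

section Runs

variable {m n : ℕ} {A : Access m n} {c d : Prog} {T T' : ℕ} {s s' s'' : Memory}

theorem Runs.of_step (h : ∀ K, step A (c :: K, s) = (K, s')) : Runs A c 1 s s' :=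
  ⟨1, le_rfl, h⟩

theorem Runs.mono (h : Runs A c T s s') (hT : T ≤ T') : Runs A c T' s s' :=
  let ⟨t, ht, hr⟩ := h
  ⟨t, ht.trans hT, hr⟩

theorem Runs.seq (hc : Runs A c T s s') (hd : Runs A d T' s' s'') :
    Runs A (.seq c d) (T + T' + 1) s s'' := by
  obtain ⟨t, ht, hc⟩ := hc
  obtain ⟨t', ht', hd⟩ := hd
  refine ⟨t' + t + 1, by omega, fun K => ?_⟩
  rw [Function.iterate_succ_apply, Function.iterate_add_apply]
  exact (congrArg _ (hc (d :: K))).trans (hd K)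

/-- A loop whose test holds exactly for the first `N` rounds, by an invariant that counts rounds. -/
theorem Runs.loop {t : Test} (N : ℕ) (I : ℕ → Memory → Prop) (h0 : I 0 s)
    (hstep : ∀ k < N, ∀ s, I k s → t.Holds s ∧ ∃ s', I (k + 1) s' ∧ Runs A c T s s')
    (hexit : ∀ s, I N s → ¬ t.Holds s) :
    ∃ s', I N s' ∧ Runs A (.loop t c) (N * (T + 1) + 1) s s' := by
  have aux : ∀ r k s, k + r = N → I k s →
      ∃ s', I N s' ∧ Runs A (.loop t c) (r * (T + 1) + 1) s s' := by
    intro r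
    induction r with
    | zero =>
      intro k s hk hI
      obtain rfl : k = N := by simpa using hk
      refine ⟨s, hI, (Runs.of_step fun K => ?_).mono (by simp)⟩
      simp [step, hexit s hI]
    | succ r ih =>
      intro k s hk hI
      obtain ⟨hT, s', hI', t1, ht1, hr1⟩ := hstep k (by omega) s hI
      obtain ⟨s'', hI'', t2, ht2, hr2⟩ := ih (k + 1) s' (by omega) hI'
      refine ⟨s'', hI'', t2 + t1 + 1, by linarith, fun K => ?_⟩
      have h : step A (.loop t c :: K, s) = (c :: .loop t c :: K, s) := by simp [step, hT]
      rw [Function.iterate_succ_apply, Function.iterate_add_apply, h, hr1, hr2]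
  exact aux N 0 s (zero_add N) h0

end Runs

/-! ### The program -/

/-- Real register `5` becomes `sampleBound m ε H L`, where `L` counts the doublings of `δ`. -/
def boundProg : Prog :=
  .seq (.const 3 1) <| .seq (.add 4 4 3) <|
  .seq (.loop (.idxLt 2 0) (.seq (.add 4 4 3) (.succ 2))) <|
  .seq (.mul 5 4 2) <| .seq (.div 5 5 0) <| .seq (.mul 5 5 5) <|
  .seq (.loop (.regLt 1 3) (.seq (.add 1 1 1) (.add 4 4 3))) (.mul 5 5 4)

/-- Array `1` becomes the indicator function of the bundle that `ALG` gives to bidder `idx 3`. -/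
def bundleProg : Prog :=
  .seq (.zero 2) <| .loop (.idxLt 2 0) <|
    .seq (.alg 7 3 2) <| .seq (.store 1 2 7) (.succ 2)

/-- The additive function supporting the bundle in array `1` for bidder `idx 3` is added, on this
bundle, to array `0`. -/
def supportProg : Prog :=
  .seq (.zero 2) <| .loop (.idxLt 2 0) <|
    .seq (.xos 7 3 1 2) <| .seq (.load 8 1 2) <| .seq (.mul 7 7 8) <| .seq (.load 8 0 2) <|
    .seq (.add 7 7 8) <| .seq (.store 0 2 7) (.succ 2)

/-- The contributions of the items on the profile at hand are added to array `0`. -/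
def sampleProg : Prog :=
  .seq (.add 6 6 3) <| .seq (.zero 3) <|
  .seq (.loop (.idxLt 3 1) (.seq bundleProg (.seq supportProg (.succ 3)))) .draw

/-- Array `0` is divided by twice the number of samples. -/
def averageProg : Prog :=
  .seq (.add 6 6 6) <| .seq (.zero 2) <| .loop (.idxLt 2 0) <|
    .seq (.load 7 0 2) <| .seq (.div 7 7 6) <| .seq (.store 0 2 7) (.succ 2)

/-- The prices are half of the average contributions of the items on a sample. -/
def priceProg : Prog :=
  .seq boundProg <| .seq (.loop (.regLt 6 5) sampleProg) averageProg

/-- The memory while the profiles are processed, up to the arrays and the scratch registers: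
`R` is the bound on the number of samples, `d` profiles are done, real register `6` contains `c`, and
the current bidder is `i`. -/
structure Sampling (m n : ℕ) (R c : ℝ) (d i : ℕ) (s : Memory) : Prop where
  items : s.idx 0 = m
  bidders : s.idx 1 = n
  bidder : s.idx 3 = i
  one : s.reg 3 = 1
  bound : s.reg 5 = R
  count : s.reg 6 = c
  drawn : s.drawn = d

section Correctness

variable {m n : ℕ} {A : Access m n} {R c : ℝ} {d i : ℕ}

open Classical in
theorem bundleProg_runs (hi : i < n) {a : Fin m → ℝ} {s : Memory} (hs : Sampling m n R c d i s)
    (ha : ∀ j : Fin m, s.arr 0 j = a j) :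
    ∃ s', (Sampling m n R c d i s' ∧ (∀ j : Fin m, s'.arr 0 j = a j) ∧
        ∀ j : Fin m, s'.arr 1 j = if j ∈ A.ALG (A.samples d) ⟨i, hi⟩ then 1 else 0) ∧
      Runs A bundleProg (6 * m + 3) s s' := by
  obtain ⟨s', hI, hr⟩ := Runs.loop (A := A) (t := .idxLt 2 0)
    (c := .seq (.alg 7 3 2) <| .seq (.store 1 2 7) (.succ 2)) (T := 5) (s := s.setIdx 2 0) m
    (fun k s => Sampling m n R c d i s ∧ s.idx 2 = k ∧ (∀ j : Fin m, s.arr 0 j = a j) ∧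
      ∀ j : Fin m, (j : ℕ) < k → s.arr 1 j = if j ∈ A.ALG (A.samples d) ⟨i, hi⟩ then 1 else 0)
    ⟨⟨hs.1, hs.2, hs.3, hs.4, hs.5, hs.6, hs.7⟩, by simp [Memory.setIdx], ha, by simp⟩
    (by
      rintro k hk s ⟨hs, h2, h0, h1⟩
      refine ⟨by simpa [Test.Holds, h2, hs.items] using hk, _, ?_,
        (Runs.of_step fun _ => rfl).seq <| (Runs.of_step fun _ => rfl).seq <|
        Runs.of_step fun _ => rfl⟩
      refine ⟨⟨hs.1, hs.2, hs.3, hs.4, hs.5, hs.6, hs.7⟩,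
        by simp [Memory.setIdx, Memory.setArr, Memory.setReg, h2],
        by simpa [Memory.setIdx, Memory.setArr, Memory.setReg] using h0, fun j hj => ?_⟩
      by_cases h : (j : ℕ) = k
      · obtain rfl : j = ⟨k, hk⟩ := Fin.ext h
        simp [Memory.setIdx, Memory.setArr, Memory.setReg, h2, Access.algBit, hs.bidder,
          hs.drawn, hi, hk]
      · simpa [Memory.setIdx, Memory.setArr, Memory.setReg, h2, h] using h1 j (by omega))
    (fun s ⟨hs, h2, _⟩ => by simp [Test.Holds, h2, hs.items])
  exact ⟨s', ⟨hI.1, hI.2.2.1, fun j => hI.2.2.2 j j.2⟩,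
    ((Runs.of_step fun _ => rfl).seq hr).mono (by omega)⟩

open Classical in
theorem supportProg_runs (hi : i < n) {a : Fin m → ℝ} {s : Memory} (hs : Sampling m n R c d i s)
    (ha : ∀ j : Fin m, s.arr 0 j = a j)
    (hb : ∀ j : Fin m, s.arr 1 j = if j ∈ A.ALG (A.samples d) ⟨i, hi⟩ then 1 else 0) :
    ∃ s', (Sampling m n R c d i s' ∧ ∀ j : Fin m,
        s'.arr 0 j = a j + supportValue A.ALG A.X ⟨i, hi⟩ j (A.samples d)) ∧
      Runs A supportProg (14 * m + 3) s s' := by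
  obtain ⟨s', hI, hr⟩ := Runs.loop (A := A) (t := .idxLt 2 0)
    (c := .seq (.xos 7 3 1 2) <| .seq (.load 8 1 2) <| .seq (.mul 7 7 8) <| .seq (.load 8 0 2) <|
      .seq (.add 7 7 8) <| .seq (.store 0 2 7) (.succ 2)) (T := 13) (s := s.setIdx 2 0) m
    (fun k s => Sampling m n R c d i s ∧ s.idx 2 = k ∧
      (∀ j : Fin m, s.arr 1 j = if j ∈ A.ALG (A.samples d) ⟨i, hi⟩ then 1 else 0) ∧
      ∀ j : Fin m, s.arr 0 j =
        if (j : ℕ) < k then a j + supportValue A.ALG A.X ⟨i, hi⟩ j (A.samples d) else a j)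
    ⟨⟨hs.1, hs.2, hs.3, hs.4, hs.5, hs.6, hs.7⟩, by simp [Memory.setIdx], hb,
      by simpa [Memory.setIdx] using ha⟩
    (by
      rintro k hk s ⟨hs, h2, h1, h0⟩
      refine ⟨by simpa [Test.Holds, h2, hs.items] using hk, _, ?_,
        (Runs.of_step fun _ => rfl).seq <| (Runs.of_step fun _ => rfl).seq <|
        (Runs.of_step fun _ => rfl).seq <| (Runs.of_step fun _ => rfl).seq <|
        (Runs.of_step fun _ => rfl).seq <| (Runs.of_step fun _ => rfl).seq <|
        Runs.of_step fun _ => rfl⟩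
      refine ⟨⟨hs.1, hs.2, hs.3, hs.4, hs.5, hs.6, hs.7⟩,
        by simp [Memory.setIdx, Memory.setArr, Memory.setReg, h2],
        by simpa [Memory.setIdx, Memory.setArr, Memory.setReg] using h1, fun j => ?_⟩
      by_cases h : (j : ℕ) = k
      · obtain rfl : j = ⟨k, hk⟩ := Fin.ext h
        have hset : (Finset.univ.filter fun l : Fin m => s.arr 1 l ≠ 0) =
            A.ALG (A.samples d) ⟨i, hi⟩ := by
          ext l
          simp [h1]
        have h0' : s.arr 0 k = a ⟨k, hk⟩ := by simpa using h0 ⟨k, hk⟩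
        have h1' := h1 ⟨k, hk⟩
        have hx : A.xosValue s i 1 k = A.X ⟨i, hi⟩ (A.samples d ⟨i, hi⟩)
            (A.ALG (A.samples d) ⟨i, hi⟩) ⟨k, hk⟩ := by
          rw [← hset]
          simp [Access.xosValue, hi, hk, hs.drawn]
        simp only at h1'
        -- at an item outside the bundle the oracle's answer is cancelled by the factor `0`
        simp [Memory.setIdx, Memory.setArr, Memory.setReg, h2, hs.bidder, hx, h0', h1',
          supportValue, add_comm]
      · have hlt : (j : ℕ) < k + 1 ↔ (j : ℕ) < k := by omega
        simpa [Memory.setIdx, Memory.setArr, Memory.setReg, h2, h, hlt] using h0 j)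
    (fun s ⟨hs, h2, _⟩ => by simp [Test.Holds, h2, hs.items])
  exact ⟨s', ⟨hI.1, fun j => by simpa using hI.2.2.2 j⟩,
    ((Runs.of_step fun _ => rfl).seq hr).mono (by omega)⟩

theorem sampleProg_runs {a : Fin m → ℝ} {s : Memory} (hs : Sampling m n R c d i s)
    (ha : ∀ j : Fin m, s.arr 0 j = a j) :
    ∃ s', (Sampling m n R (c + 1) (d + 1) n s' ∧ ∀ j : Fin m,
        s'.arr 0 j = a j + itemValue A.ALG A.X (A.samples d) j) ∧
      Runs A sampleProg (n * (20 * m + 10) + 7) s s' := by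
  obtain ⟨s', hI, hr⟩ := Runs.loop (A := A) (t := .idxLt 3 1)
    (c := .seq bundleProg (.seq supportProg (.succ 3))) (T := 20 * m + 9)
    (s := (s.setReg 6 (s.reg 6 + s.reg 3)).setIdx 3 0) n
    (fun k s => Sampling m n R (c + 1) d k s ∧ ∀ j : Fin m, s.arr 0 j =
      a j + ∑ i : Fin n, if (i : ℕ) < k then supportValue A.ALG A.X i j (A.samples d) else 0)
    ⟨⟨hs.1, hs.2, rfl, hs.4, hs.5, by simp [Memory.setIdx, Memory.setReg, hs.count, hs.one],
      hs.7⟩, by simpa [Memory.setIdx, Memory.setReg] using ha⟩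
    (by
      rintro k hk s ⟨hs, h0⟩
      obtain ⟨s1, ⟨hs1, h01, h11⟩, hr1⟩ := bundleProg_runs (A := A) hk hs h0
      obtain ⟨s2, ⟨hs2, h02⟩, hr2⟩ := supportProg_runs (A := A) hk hs1 h01 h11
      refine ⟨by simpa [Test.Holds, hs.bidders, hs.bidder] using hk, _, ?_,
        (hr1.seq (hr2.seq (Runs.of_step fun _ => rfl))).mono (by omega)⟩
      refine ⟨⟨hs2.1, hs2.2, by simp [Memory.setIdx, hs2.bidder], hs2.4, hs2.5, hs2.6, hs2.7⟩,
        fun j => ?_⟩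
      have hsum : ∀ x : Fin n, (if (x : ℕ) < k + 1 then
          supportValue A.ALG A.X x j (A.samples d) else 0) =
          (if (x : ℕ) < k then supportValue A.ALG A.X x j (A.samples d) else 0) +
          if x = ⟨k, hk⟩ then supportValue A.ALG A.X x j (A.samples d) else 0 := by
        intro x
        rcases lt_trichotomy (x : ℕ) k with h | h | h
        · simp [h, Nat.lt_succ_of_lt h, Fin.ext_iff, h.ne]
        · simp [h, Fin.ext_iff]
        · simp [h.not_gt, h.ne', Fin.ext_iff, show ¬ (x : ℕ) < k + 1 by omega]
      simp only [hsum, Finset.sum_add_distrib]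
      simp [Memory.setIdx, h02, add_assoc])
    (fun s ⟨hs, _⟩ => by simp [Test.Holds, hs.bidders, hs.bidder])
  refine ⟨{ s' with drawn := s'.drawn + 1 }, ⟨⟨hI.1.1, hI.1.2, hI.1.3, hI.1.4, hI.1.5, hI.1.6,
    by simp [hI.1.drawn]⟩, fun j => by simpa [itemValue] using hI.2 j⟩,
    Runs.mono ((Runs.of_step fun _ => rfl).seq <| (Runs.of_step fun _ => rfl).seq <|
      hr.seq (Runs.of_step fun _ => rfl)) (le_of_eq (by ring))⟩

theorem averageProg_runs {a : Fin m → ℝ} {s : Memory} (hs : Sampling m n R c d i s)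
    (ha : ∀ j : Fin m, s.arr 0 j = a j) :
    ∃ s', (∀ j : Fin m, s'.arr 0 j = a j / (c + c)) ∧ Runs A averageProg (8 * m + 5) s s' := by
  obtain ⟨s', hI, hr⟩ := Runs.loop (A := A) (t := .idxLt 2 0)
    (c := .seq (.load 7 0 2) <| .seq (.div 7 7 6) <| .seq (.store 0 2 7) (.succ 2)) (T := 7)
    (s := (s.setReg 6 (s.reg 6 + s.reg 6)).setIdx 2 0) m
    (fun k s => Sampling m n R (c + c) d i s ∧ s.idx 2 = k ∧
      ∀ j : Fin m, s.arr 0 j = if (j : ℕ) < k then a j / (c + c) else a j)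
    ⟨⟨hs.1, hs.2, hs.3, hs.4, hs.5, by simp [Memory.setIdx, Memory.setReg, hs.count], hs.7⟩,
      by simp [Memory.setIdx], by simpa [Memory.setIdx, Memory.setReg] using ha⟩
    (by
      rintro k hk s ⟨hs, h2, h0⟩
      refine ⟨by simpa [Test.Holds, h2, hs.items] using hk, _, ?_,
        (Runs.of_step fun _ => rfl).seq <| (Runs.of_step fun _ => rfl).seq <|
        (Runs.of_step fun _ => rfl).seq <| Runs.of_step fun _ => rfl⟩
      refine ⟨⟨hs.1, hs.2, hs.3, hs.4, hs.5, hs.6, hs.7⟩,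
        by simp [Memory.setIdx, Memory.setArr, Memory.setReg, h2], fun j => ?_⟩
      by_cases h : (j : ℕ) = k
      · have h0' : s.arr 0 k = a j := by simpa [h] using h0 j
        simp [Memory.setIdx, Memory.setArr, Memory.setReg, h2, h, h0', hs.count]
      · have hlt : (j : ℕ) < k + 1 ↔ (j : ℕ) < k := by omega
        simpa [Memory.setIdx, Memory.setArr, Memory.setReg, h2, h, hlt] using h0 j)
    (fun s ⟨hs, h2, _⟩ => by simp [Test.Holds, h2, hs.items])
  exact ⟨s', fun j => by simpa using hI.2.2 j, Runs.mono ((Runs.of_step fun _ => rfl).seq <|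
    (Runs.of_step fun _ => rfl).seq hr) (by omega)⟩

theorem boundProg_runs {ε δ H : ℝ} {L : ℕ} (hL : 1 ≤ 2 ^ L * δ) (hL' : ∀ k < L, 2 ^ k * δ < 1) :
    ∃ s', (Sampling m n (sampleBound m ε H L) 0 0 0 s' ∧ ∀ j : Fin m, s'.arr 0 j = 0) ∧
      Runs A boundProg (4 * m + 4 * L + 15) (startMemory m n ε δ H) s' := by
  obtain ⟨s1, hI1, hr1⟩ := Runs.loop (A := A) (t := .idxLt 2 0)
    (c := .seq (.add 4 4 3) (.succ 2)) (T := 3)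
    (s := ((startMemory m n ε δ H).setReg 3 ((1 : ℚ) : ℝ)).setReg 4
      (((startMemory m n ε δ H).setReg 3 ((1 : ℚ) : ℝ)).reg 4 +
        ((startMemory m n ε δ H).setReg 3 ((1 : ℚ) : ℝ)).reg 3)) m
    (fun k s => Sampling m n 0 0 0 0 s ∧ s.idx 2 = k ∧ s.reg 0 = ε ∧ s.reg 1 = δ ∧ s.reg 2 = H ∧
      s.reg 4 = k + 1 ∧ ∀ j : Fin m, s.arr 0 j = 0)
    (by
      refine ⟨⟨?_, ?_, ?_, ?_, ?_, ?_, ?_⟩, ?_⟩ <;> simp [Memory.setReg, startMemory])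
    (by
      rintro k hk s ⟨hs, h2, h⟩
      refine ⟨by simpa [Test.Holds, h2, hs.items] using hk, _, ?_,
        (Runs.of_step fun _ => rfl).seq <| Runs.of_step fun _ => rfl⟩
      refine ⟨⟨hs.1, hs.2, hs.3, hs.4, hs.5, hs.6, hs.7⟩, ?_⟩
      simp [Memory.setIdx, Memory.setReg, h2, h, hs.one])
    (fun s ⟨hs, h2, _⟩ => by simp [Test.Holds, h2, hs.items])
  obtain ⟨hs1, -, hε1, hδ1, hH1, h41, ha1⟩ := hI1
  obtain ⟨s2, hI2, hr2⟩ := Runs.loop (A := A) (t := .regLt 1 3)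
    (c := .seq (.add 1 1 1) (.add 4 4 3)) (T := 3)
    (s := ((s1.setReg 5 (s1.reg 4 * s1.reg 2)).setReg 5 (s1.reg 4 * s1.reg 2 / s1.reg 0)).setReg 5
      (s1.reg 4 * s1.reg 2 / s1.reg 0 * (s1.reg 4 * s1.reg 2 / s1.reg 0))) L
    (fun k s => Sampling m n ((m + 1) * H / ε * ((m + 1) * H / ε)) 0 0 0 s ∧
      s.reg 1 = 2 ^ k * δ ∧ s.reg 4 = m + 1 + k ∧ ∀ j : Fin m, s.arr 0 j = 0)
    (by
      refine ⟨⟨hs1.1, hs1.2, hs1.3, hs1.4, ?_, hs1.6, hs1.7⟩, ?_⟩ <;>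
        simp [Memory.setReg, hε1, hδ1, hH1, h41, ha1])
    (by
      rintro k hk s ⟨hs, h1, h4, ha⟩
      refine ⟨by simpa [Test.Holds, h1, hs.one] using hL' k hk, _, ?_,
        (Runs.of_step fun _ => rfl).seq <| Runs.of_step fun _ => rfl⟩
      refine ⟨⟨hs.1, hs.2, hs.3, hs.4, hs.5, hs.6, hs.7⟩, ?_, ?_, ha⟩
      · simp only [Memory.setReg, h1, Function.update_self, ne_eq, OfNat.one_ne_ofNat,
          not_false_eq_true, Function.update_of_ne]
        ring
      · simp [Memory.setReg, h4, hs.one, add_assoc])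
    (fun s ⟨hs, h1, _⟩ => by simpa [Test.Holds, h1, hs.one] using hL)
  obtain ⟨hs2, -, h42, ha2⟩ := hI2
  refine ⟨s2.setReg 5 (s2.reg 5 * s2.reg 4), ⟨⟨hs2.1, hs2.2, hs2.3, hs2.4, ?_, hs2.6, hs2.7⟩,
    ha2⟩, Runs.mono ((Runs.of_step fun _ => rfl).seq <| (Runs.of_step fun _ => rfl).seq <|
      hr1.seq <| (Runs.of_step fun _ => rfl).seq <| (Runs.of_step fun _ => rfl).seq <|
      (Runs.of_step fun _ => rfl).seq <| hr2.seq (Runs.of_step fun _ => rfl)) (by omega)⟩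
  simp [Memory.setReg, hs2.bound, h42, sampleBound]

/-- Here `L` is the number of doublings of `δ`, and `N` is the number of samples. -/
theorem priceProg_runs {ε δ H : ℝ} {L : ℕ} (hL : 1 ≤ 2 ^ L * δ) (hL' : ∀ k < L, 2 ^ k * δ < 1)
    {N : ℕ} (hN : N = ⌈sampleBound m ε H L⌉₊) :
    ∃ s', (∀ j : Fin m, s'.arr 0 j =
        (∑ k ∈ Finset.range N, itemValue A.ALG A.X (A.samples k) j) / (N + N)) ∧
      Runs A priceProg (12 * m + 4 * L + N * (n * (20 * m + 10) + 8) + 23)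
        (startMemory m n ε δ H) s' := by
  obtain ⟨s1, ⟨hs1, ha1⟩, hr1⟩ := boundProg_runs (m := m) (n := n) (A := A) (ε := ε) (H := H) hL hL'
  obtain ⟨s2, ⟨⟨i, hs2⟩, ha2⟩, hr2⟩ := Runs.loop (A := A) (t := .regLt 6 5)
    (c := sampleProg) (T := n * (20 * m + 10) + 7) (s := s1) N
    (fun k s => (∃ i, Sampling m n (sampleBound m ε H L) k k i s) ∧ ∀ j : Fin m, s.arr 0 j =
      ∑ k ∈ Finset.range k, itemValue A.ALG A.X (A.samples k) j)
    ⟨⟨0, by simpa using hs1⟩, by simpa using ha1⟩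
    (by
      rintro k hk s ⟨⟨i, hs⟩, ha⟩
      obtain ⟨s', ⟨hs', ha'⟩, hr⟩ := sampleProg_runs (A := A) hs ha
      refine ⟨by simpa [Test.Holds, hs.count, hs.bound] using Nat.lt_ceil.1 (hN ▸ hk), s',
        ⟨⟨n, by exact_mod_cast hs'⟩, fun j => ?_⟩, hr⟩
      rw [ha', Finset.sum_range_succ])
    (by
      rintro s ⟨⟨i, hs⟩, -⟩
      simpa [Test.Holds, hs.count, hs.bound, hN] using Nat.le_ceil _)
  obtain ⟨s3, ha3, hr3⟩ := averageProg_runs (A := A) hs2 ha2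
  exact ⟨s3, ha3, (hr1.seq (hr2.seq hr3)).mono (le_of_eq (by ring))⟩

end Correctness

/-! ### Running time and success probability -/

theorem exists_doublings {δ : ℝ} (hδ : 0 < δ) (hδ1 : δ < 1) :
    ∃ L : ℕ, 1 ≤ 2 ^ L * δ ∧ (∀ k < L, 2 ^ k * δ < 1) ∧ (L : ℝ) ≤ 1 + 2 * Real.log (1 / δ) := by
  classical
  have hex : ∃ L : ℕ, 1 ≤ 2 ^ L * δ := by
    obtain ⟨L, hL⟩ := pow_unbounded_of_one_lt (1 / δ) (one_lt_two : (1 : ℝ) < 2)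
    exact ⟨L, (div_le_iff₀ hδ).1 hL.le⟩
  have hmin : ∀ k < Nat.find hex, 2 ^ k * δ < 1 := fun k hk => not_le.1 (Nat.find_min hex hk)
  refine ⟨Nat.find hex, Nat.find_spec hex, hmin, ?_⟩
  rcases h : Nat.find hex with _ | k
  · have : 0 ≤ Real.log (1 / δ) := Real.log_nonneg ((one_le_div hδ).2 hδ1.le)
    simp only [Nat.cast_zero]
    positivity
  · have h1 : (2 : ℝ) ^ k < 1 / δ := (lt_div_iff₀ hδ).2 (hmin k (by omega))
    have h2 := Real.log_lt_log (by positivity) h1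
    rw [Real.log_pow] at h2
    have h3 : (1 : ℝ) / 2 ≤ Real.log 2 := by linarith [Real.log_two_gt_d9]
    have h4 : (k : ℝ) * (1 / 2) ≤ k * Real.log 2 := by gcongr
    push_cast
    linarith

/-- The running time of `priceProg` (for `N` samples) is polynomial; `x` stands for `H / ε`. -/
theorem steps_le {m n L N : ℕ} {P x : ℝ} (hx : 0 ≤ x) (hP : 1 + m + n + x ≤ P)
    (hL : (L : ℝ) ≤ 2 * P)
    (hN : (N : ℝ) ≤ ((m + 1) * x) * ((m + 1) * x) * (m + 1 + L) + 1) :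
    ((12 * m + 4 * L + N * (n * (20 * m + 10) + 8) + 23 : ℕ) : ℝ) ≤ 200 * P ^ 7 := by
  have hm0 : (0 : ℝ) ≤ m := m.cast_nonneg
  have hn0 : (0 : ℝ) ≤ n := n.cast_nonneg
  have h1 : 1 ≤ P := by linarith
  have hP0 : 0 ≤ P := by linarith
  have hm : (m : ℝ) + 1 ≤ P := by linarith
  have hm' : (m : ℝ) ≤ P := by linarith
  have hn : (n : ℝ) ≤ P := by linarith
  have hxP : x ≤ P := by linarith
  have hN' : (N : ℝ) ≤ 4 * P ^ 5 := by
    have e : ((m + 1) * x) * ((m + 1) * x) * (m + 1 + L) ≤ (P * P) * (P * P) * (P + 2 * P) := by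
      gcongr
    have : (1 : ℝ) ≤ P ^ 5 := one_le_pow₀ h1
    nlinarith
  have hB : (n : ℝ) * (20 * m + 10) + 8 ≤ 38 * P ^ 2 := by
    have e : (n : ℝ) * (20 * m + 10) ≤ P * (20 * P + 10 * P) := by
      gcongr
      linarith
    have : (1 : ℝ) ≤ P ^ 2 := one_le_pow₀ h1
    nlinarith
  have hNB : (N : ℝ) * (n * (20 * m + 10) + 8) ≤ (4 * P ^ 5) * (38 * P ^ 2) := by gcongr
  have h7 : P ≤ P ^ 7 := le_self_pow₀ h1 (by norm_num)
  have : (1 : ℝ) ≤ P ^ 7 := one_le_pow₀ h1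
  push_cast
  nlinarith

/-- With probability at least `1 - δ`, half of the average contributions of the items on enough
samples are good prices. -/
theorem measure_not_goodPrices_le {m n : ℕ} {ε δ H : ℝ} (hε : 0 < ε) (hH : 0 < H)
    {τ : Fin n → Measure (BidderType m)} [∀ i, IsProbabilityMeasure (τ i)]
    {ALG : (Fin n → SetValuation m) → Fin n → Finset (Fin m)}
    {X : Fin n → SetValuation m → Finset (Fin m) → Fin m → ℝ}
    (hτ : ∀ i, ∀ᵐ θ ∂(τ i), IsBidderType θ ∧ IsXOS (liquid θ) ∧ liquid θ Finset.univ ≤ H)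
    (hALG : IsAllocationAlgorithm ALG) (hX : IsXOSOracle X) {L N : ℕ} (hL : 1 ≤ 2 ^ L * δ)
    (hN : sampleBound m ε H L ≤ N) :
    (Measure.infinitePi fun _ : ℕ => Measure.pi τ) {ω | ¬ GoodPrices τ ALG ε fun j =>
      (∑ k ∈ Finset.range N, itemValue ALG X (liquidProfile (ω k)) j) / (N + N)} ≤
        ENNReal.ofReal δ := by
  have hq : ∀ᵐ θ ∂(Measure.pi τ), ∀ j, itemValue ALG X (liquidProfile θ) j ∈ Set.Icc 0 H := by
    filter_upwards [ae_profile hτ] with θ hθ j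
    exact itemValue_mem_Icc hALG hX (fun i => (hθ i).2.1) hH.le (fun i => (hθ i).2.2) j
  refine le_trans (measure_mono_ae ?_) (measure_exists_abs_sum_sub_ge_le (Measure.pi τ)
    (fun j => (measurable_itemValue hALG hX j).comp measurable_liquidProfile) hε hH hq hL hN)
  have hall : ∀ᵐ ω ∂(Measure.infinitePi fun _ : ℕ => Measure.pi τ), ∀ k : ℕ, ∀ j,
      itemValue ALG X (liquidProfile (ω k)) j ∈ Set.Icc 0 H :=
    ae_all_iff.2 fun k =>
      (measurePreserving_eval_infinitePi (fun _ : ℕ => Measure.pi τ) k).quasiMeasurePreserving.ae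
        hq
  filter_upwards [hall] with ω hω hbad
  by_contra hdev
  refine hbad (goodPrices_of_abs_sub_le hALG hX hτ hH.le (η := 4 * ε / (m + 1)) ?_ ?_ ?_)
  · exact fun j => div_nonneg (Finset.sum_nonneg fun k _ => (hω k j).1) (by positivity)
  · rw [mul_div_assoc', div_le_iff₀ (by positivity)]
    linarith
  · intro j
    have hN0 : (0 : ℝ) < N := lt_of_lt_of_le (by unfold sampleBound; positivity) hN
    have h : |∑ k ∈ Finset.range N, itemValue ALG X (liquidProfile (ω k)) j -
        N * ∫ θ, itemValue ALG X (liquidProfile θ) j ∂(Measure.pi τ)| <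
          N * (4 * ε / (m + 1)) := not_le.1 fun h => hdev ⟨j, h⟩
    refine le_of_mul_le_mul_left (a := (N : ℝ)) ?_ hN0
    refine le_of_eq_of_le ?_ h.le
    rw [← abs_of_pos hN0, ← abs_mul, abs_of_pos hN0]
    congr 1
    field_simp
    ring

end LiquidAuction

open LiquidAuction
theorem theorem3 :
    ∃ (prog : Prog) (C k : ℕ),
      ∀ (m n : ℕ) (ε δ H : ℝ), 0 < ε → 0 < δ → δ < 1 → 0 < H →
      ∀ (τ : Fin n → Measure (BidderType m)) [∀ i, IsProbabilityMeasure (τ i)]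
        (ALG : (Fin n → SetValuation m) → Fin n → Finset (Fin m))
        (X : Fin n → SetValuation m → Finset (Fin m) → Fin m → ℝ),
        (∀ i, ∀ᵐ θ ∂(τ i),
          IsBidderType θ ∧ IsXOS (liquid θ) ∧ liquid θ Finset.univ ≤ H) →
        IsAllocationAlgorithm ALG →
        IsXOSOracle X →
        ∃ price : (ℕ → Fin n → BidderType m) → Fin m → ℝ,
          (∀ ω : ℕ → Fin n → BidderType m, ∃ t : ℕ,
            (t : ℝ) ≤ C * (1 + m + n + H / ε + Real.log (1 / δ)) ^ k ∧
            ComputesPrices prog ⟨fun s => liquidProfile (ω s), ALG, X⟩ ε δ H t (price ω)) ∧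
          (Measure.infinitePi fun _ : ℕ => Measure.pi τ)
            {ω | ¬ GoodPrices τ ALG ε (price ω)} ≤ ENNReal.ofReal δ := by
  refine ⟨priceProg, 200, 7, fun m n ε δ H hε hδ hδ1 hH τ _ ALG X hτ hALG hX => ?_⟩
  obtain ⟨L, hL, hL', hLlog⟩ := exists_doublings hδ hδ1
  have hlog : 0 ≤ Real.log (1 / δ) := Real.log_nonneg ((one_le_div hδ).2 hδ1.le)
  refine ⟨_, fun ω => ?_, measure_not_goodPrices_le hε hH hτ hALG hX hL
    (Nat.le_ceil (sampleBound m ε H L))⟩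
  obtain ⟨s', hs', t, ht, hrun⟩ := priceProg_runs (n := n)
    (A := ⟨fun s => liquidProfile (ω s), ALG, X⟩) (ε := ε) (H := H) hL hL' rfl
  refine ⟨t, le_trans (Nat.cast_le.2 ht) ?_, by rw [hrun], fun j => by rw [hrun]; exact hs' j⟩
  have hx : 0 ≤ H / ε := (div_pos hH hε).le
  have hm0 : (0 : ℝ) ≤ m := m.cast_nonneg
  have hn0 : (0 : ℝ) ≤ n := n.cast_nonneg
  refine steps_le (x := H / ε) hx (by linarith) (by linarith) ?_
  refine (Nat.ceil_lt_add_one (by unfold sampleBound; positivity)).le.trans_eq ?_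
  rw [sampleBound]
  ring
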